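/- Let $R>0$, let $D\subset\mathbb{R}^2$ be the disk of radius $R$ centred at the origin, with polar coordinates $(\rho,\theta)$, and for $\nu\in\mathbb{Z}$ let $J_\nu(x)=\sum_{m\ge 0}\frac{(-1)^m}{m!\,\Gamma(m+\nu+1)}\left(\frac{x}{2}\right)^{2m+\nu}$ be the Bessel function of the first kind of order $\nu$ (with $1/\Gamma=0$ at the poles of $\Gamma$). For each $\nu\in\mathbb{Z}$ let $Z_\nu$ be the set of all $k>0$ with $J_\nu'(kR)=0$, together with $k=0$ if $\nu=0$. Then each $Z_\nu$ can be written as the range of a strictly increasing sequence indexed by $\mathbb{N}=\{0,1,2,\dots\}$. Moreover, for every choice of enumerations without repetition $j\mapsto k_{\nu,j}$ ($j\in\mathbb{N}$) of the sets $Z_\nu$, $\nu\in\mathbb{Z}$, the functions $$N_{\nu,j}\,J_\nu(k_{\nu,j}\rho)\,e^{i\nu\theta},\qquad N_{\nu,j}=\frac{1}{\sqrt{2\pi\int_0^R\rho\,J_\nu(k_{\nu,j}\rho)^2\,d\rho}},\qquad \nu\in\mathbb{Z},\ j\in\mathbb{N},$$ form an orthonormal (Hilbert) basis of the complex Hilbert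 space $L^2(D;\mathbb{C})$ with respect to Lebesgue measure $\rho\,d\rho\,d\theta$; in particular every real-valued square-integrable function on $D$ is the $L^2$-limit of its expansion in these functions. -/

import Mathlib

open MeasureTheory

noncomputable section

/-- The Bessel function of the first kind of integer order `ν`,
`J_ν(x) = ∑_{m ≥ 0} (-1)^m / (m! Γ(m + ν + 1)) (x / 2)^(2m + ν)`.
At the poles of `Γ` Mathlib has `Γ = 0`, hence `1 / Γ = 0`, which is the usual convention for
negative integer orders: the terms with `m + ν < 0` vanish. -/
def besselJ (ν : ℤ) (x : ℝ) : ℝ :=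
  ∑' m : ℕ, (-1 : ℝ) ^ m / ((Nat.factorial m : ℝ) * Real.Gamma ((m : ℝ) + (ν : ℝ) + 1)) *
    (x / 2) ^ (2 * (m : ℤ) + ν)

/-- The admissible radial wave numbers of angular order `ν` on the disk of radius `R`: the
solutions `k ≥ 0` of `J_ν'(k R) = 0`, where `k = 0` is counted only for `ν = 0` (for `ν ≠ 0` the
function `ρ ↦ J_ν(0 ρ)` is identically zero). -/
def waveNumbers (R : ℝ) (ν : ℤ) : Set ℝ :=
  {k : ℝ | (0 < k ∨ (k = 0 ∧ ν = 0)) ∧ deriv (besselJ ν) (k * R) = 0}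

/-- The normalisation `N = 1 / √(2π ∫_0^R ρ J_ν(k ρ)² dρ)`. -/
def besselNorm (R : ℝ) (ν : ℤ) (k : ℝ) : ℝ :=
  1 / Real.sqrt (2 * Real.pi * ∫ ρ in (0 : ℝ)..R, ρ * besselJ ν (k * ρ) ^ 2)

/-- The function `N J_ν(k ρ) e^{iνθ}` of the polar coordinates `ρ`, `θ`. -/
def besselMode (R : ℝ) (ν : ℤ) (k ρ θ : ℝ) : ℂ :=
  (besselNorm R ν k : ℂ) * (besselJ ν (k * ρ) : ℂ) * Complex.exp (Complex.I * (ν : ℂ) * (θ : ℂ))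

/-- Lebesgue measure on the disk of radius `R` about the origin of the plane; the plane is
`ℂ`, so that the polar coordinates of `z` are `ρ = ‖z‖` and `θ = Complex.arg z`. -/
def diskMeasure (R : ℝ) : Measure ℂ :=
  (volume : Measure ℂ).restrict (Metric.ball (0 : ℂ) R)

end

/-!
Write `n = |ν|`. The modes are normalised multiples of `φ_z(ρ) e^{iνθ}` with `z = k²`, where
`φ_z(r) = r^n E_n(-z r²)` is the solution of `r (r φ')' = (n² - z r²) φ` that is regular at the
origin and `E_n` is an entire function. With the boundary flux `g(z) = R φ_z'(R)`, an entire
function of `z`, the wave numbers are the square roots of the zeros of `g`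
(`mem_waveNumbers_iff`). Orthogonality of the modes is Lagrange's identity
`(z - w) ∫_0^R r φ_z φ_w dr = φ_z(R) R φ_w'(R) - R φ_z'(R) φ_w(R)` together with polar
coordinates.

Completeness is obtained without the spectral theorem, from the theory of entire functions.
Lagrange's identity for `z` and `z̄`, the energy identity and a trace inequality give
`R |Im z| ‖φ_z‖ ≤ √(2 + R² + 2 |z|) |g(z)|` (`abs_im_sq_mul_radialNormSq_le`); in particular the
zeros of `g` are real, and Lagrange's identity also shows that they are simple. If `f` is
orthogonal to all modes of order `ν`, then `F(z) = ⟪f, φ_z e^{iνθ}⟫` is an entire function that vanishes at the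
zeros of `g`, so that `F / g` is entire, and `|F / g| ≤ C √(1 + |z|) / |Im z|`. Such a function is
zero by the maximum principle (`eq_zero_of_norm_mul_abs_im_le`). The Taylor coefficients of `F` are
nonzero multiples of the moments of `f` against `ρ^{2m + n} e^{iνθ}`, hence these vanish
(`diskMoment_eq_zero`). If this holds for all `ν`, then `f` is orthogonal to all monomials `x^a x̄^b`
and vanishes by the Stone–Weierstrass theorem (`ae_eq_zero_of_moments`).

Completeness in the single order `ν` also shows that there are infinitely many wave numbers: with
finitely many, the independent functions `ρ^{2m + n} e^{iνθ}` would span a space of finite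
dimension. As the zeros of `g` are isolated, the wave numbers can be listed in increasing order.
-/

/-! ### Everywhere convergent power series -/

/-- The coefficients of a power series that converges absolutely on all of `ℂ`. -/
def EntireCoeff (a : ℕ → ℂ) : Prop :=
  ∀ r : ℝ, Summable fun m : ℕ => ‖a m‖ * r ^ m

theorem EntireCoeff.of_norm_le {a : ℕ → ℂ} {C K : ℝ}
    (h : ∀ m : ℕ, ‖a m‖ ≤ C * (K ^ m / (m.factorial : ℝ))) : EntireCoeff a := by
  intro r
  have h1 : Summable fun m : ℕ => C * ((K * |r|) ^ m / (m.factorial : ℝ)) :=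
    (Real.summable_pow_div_factorial (K * |r|)).mul_left C
  refine Summable.of_norm_bounded h1 fun m => ?_
  rw [norm_mul, norm_norm, norm_pow, Real.norm_eq_abs]
  calc ‖a m‖ * |r| ^ m ≤ C * (K ^ m / (m.factorial : ℝ)) * |r| ^ m := by gcongr; exact h m
    _ = _ := by rw [mul_pow]; ring

theorem EntireCoeff.summable_norm {a : ℕ → ℂ} (h : EntireCoeff a) (z : ℂ) :
    Summable fun m => ‖a m * z ^ m‖ := by
  simpa using h ‖z‖

theorem EntireCoeff.summable {a : ℕ → ℂ} (h : EntireCoeff a) (z : ℂ) :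
    Summable fun m => a m * z ^ m :=
  (h.summable_norm z).of_norm

theorem EntireCoeff.deriv {a : ℕ → ℂ} (h : EntireCoeff a) :
    EntireCoeff fun m => (m + 1 : ℂ) * a (m + 1) := by
  intro r
  have h1 : Summable fun m : ℕ => ‖a (m + 1)‖ * (2 * (|r| + 1)) ^ (m + 1) :=
    (summable_nat_add_iff 1).2 (h (2 * (|r| + 1)))
  refine Summable.of_norm_bounded h1 fun m => ?_
  have h2 : ((m : ℝ) + 1) ≤ 2 ^ (m + 1) := by
    exact_mod_cast (Nat.lt_two_pow_self (n := m + 1)).le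
  have h3 : ‖(m + 1 : ℂ)‖ = (m : ℝ) + 1 := by
    rw [← Nat.cast_succ, Complex.norm_natCast, Nat.cast_succ]
  have h4 : |r| ^ m ≤ (|r| + 1) ^ (m + 1) :=
    (pow_le_pow_left₀ (abs_nonneg r) (by linarith) m).trans
      (pow_le_pow_right₀ (by linarith [abs_nonneg r]) (Nat.le_succ m))
  rw [norm_mul, norm_norm, norm_pow, Real.norm_eq_abs, norm_mul, h3, mul_pow]
  calc ((m : ℝ) + 1) * ‖a (m + 1)‖ * |r| ^ m
      = ‖a (m + 1)‖ * (((m : ℝ) + 1) * |r| ^ m) := by ring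
    _ ≤ _ := by gcongr

theorem EntireCoeff.hasDerivAt {a : ℕ → ℂ} (h : EntireCoeff a) (z : ℂ) :
    HasDerivAt (fun z => ∑' m, a m * z ^ m) (∑' m : ℕ, (m + 1 : ℂ) * a (m + 1) * z ^ m) z := by
  set ρ : ℝ := ‖z‖ + 1
  have hs : Summable fun m : ℕ => (m : ℝ) * ‖a m‖ * ρ ^ (m - 1) := by
    rw [← summable_nat_add_iff 1]
    refine (h.deriv ρ).congr fun m => ?_
    rw [norm_mul, ← Nat.cast_succ, Complex.norm_natCast]
    simp
  have key := hasDerivAt_tsum_of_isPreconnected (g := fun m z => a m * z ^ m)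
    (g' := fun m z => a m * (m * z ^ (m - 1))) hs (t := Metric.ball (0 : ℂ) ρ) (y₀ := 0) (y := z)
    Metric.isOpen_ball (convex_ball _ _).isPreconnected
    (fun m y _ => (hasDerivAt_pow m y).const_mul (a m))
    (fun m y hy => by
      have : ‖y‖ ≤ ρ := by simpa using (Metric.mem_ball.1 hy).le
      rw [norm_mul, norm_mul, norm_pow, Complex.norm_natCast]
      calc ‖a m‖ * (m * ‖y‖ ^ (m - 1)) = m * ‖a m‖ * ‖y‖ ^ (m - 1) := by ring
        _ ≤ _ := by gcongr)
    (Metric.mem_ball_self (by positivity)) (h.summable 0)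
    (by simp [ρ])
  refine key.congr_deriv ?_
  have hs' : Summable fun m : ℕ => a m * (m * z ^ (m - 1)) := by
    rw [← summable_nat_add_iff 1]
    refine (h.deriv.summable z).congr fun m => ?_
    push_cast
    ring
  rw [hs'.tsum_eq_zero_add]
  simp only [Nat.cast_zero, zero_mul, mul_zero, zero_add]
  refine tsum_congr fun m => ?_
  push_cast
  ring

theorem EntireCoeff.differentiable {a : ℕ → ℂ} (h : EntireCoeff a) :
    Differentiable ℂ fun z => ∑' m, a m * z ^ m :=
  fun z => (h.hasDerivAt z).differentiableAt

theorem EntireCoeff.eq_zero {a : ℕ → ℂ} (h : EntireCoeff a)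
    (h0 : ∀ z, ∑' m, a m * z ^ m = 0) (m : ℕ) : a m = 0 := by
  induction m generalizing a with
  | zero =>
    have := h0 0
    rw [tsum_eq_single 0 (fun m hm => by simp [hm])] at this
    simpa using this
  | succ m ih =>
    have h1 : ∀ z : ℂ, ∑' m : ℕ, ((m + 1 : ℂ) * a (m + 1)) * z ^ m = 0 := fun z => by
      have h2 := h.hasDerivAt z
      have h3 : (fun z => ∑' m, a m * z ^ m) = fun _ => (0 : ℂ) := funext h0
      rw [h3] at h2
      exact h2.unique (hasDerivAt_const z 0)
    have := ih h.deriv h1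
    have hm : (m + 1 : ℂ) ≠ 0 := Nat.cast_add_one_ne_zero m
    simpa [hm] using this

/-! ### The entire part of the Bessel functions -/

/-- The coefficient `1 / (4^m m! (m + n)!)` of `s^m` in the entire function `E_n` with
`J_n(x) = (x / 2)^n E_n(-x²)`. -/
noncomputable def besselCoeff (n m : ℕ) : ℝ :=
  1 / (4 ^ m * (m.factorial : ℝ) * ((m + n).factorial : ℝ))

/-- The entire function `E_n(s) = ∑ s^m / (4^m m! (m + n)!)`, so that
`J_n(x) = (x / 2)^n E_n(-x²)`. -/
noncomputable def besselEntire (n : ℕ) (s : ℂ) : ℂ :=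
  ∑' m : ℕ, (besselCoeff n m : ℂ) * s ^ m

theorem besselCoeff_pos (n m : ℕ) : 0 < besselCoeff n m := by
  unfold besselCoeff; positivity

theorem besselCoeff_le (n m : ℕ) : besselCoeff n m ≤ 1 / (m.factorial : ℝ) := by
  unfold besselCoeff
  apply one_div_le_one_div_of_le (by positivity)
  have h1 : (1 : ℝ) ≤ 4 ^ m := one_le_pow₀ (by norm_num)
  have h2 : (1 : ℝ) ≤ ((m + n).factorial : ℝ) := by exact_mod_cast Nat.factorial_pos _
  have h3 : (0 : ℝ) < (m.factorial : ℝ) := by positivity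
  calc (m.factorial : ℝ) = 1 * (m.factorial : ℝ) * 1 := by ring
    _ ≤ _ := by gcongr

theorem entireCoeff_besselCoeff (n : ℕ) : EntireCoeff fun m => (besselCoeff n m : ℂ) :=
  .of_norm_le (C := 1) (K := 1) fun m => by
    rw [Complex.norm_real, Real.norm_of_nonneg (besselCoeff_pos n m).le]
    simpa using besselCoeff_le n m

theorem succ_mul_besselCoeff (n m : ℕ) :
    ((m : ℝ) + 1) * besselCoeff n (m + 1) = besselCoeff (n + 1) m / 4 := by
  unfold besselCoeff
  rw [Nat.factorial_succ, show m + 1 + n = m + (n + 1) by ring]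
  push_cast
  have : (m : ℝ) + 1 ≠ 0 := by positivity
  field_simp
  ring

theorem hasDerivAt_besselEntire (n : ℕ) (s : ℂ) :
    HasDerivAt (besselEntire n) (besselEntire (n + 1) s / 4) s := by
  refine ((entireCoeff_besselCoeff n).hasDerivAt s).congr_deriv ?_
  rw [besselEntire, ← tsum_div_const]
  refine tsum_congr fun m => ?_
  have := congrArg (fun x : ℝ => (x : ℂ)) (succ_mul_besselCoeff n m)
  push_cast at this
  rw [this]; ring

theorem continuous_besselEntire (n : ℕ) : Continuous (besselEntire n) :=
  continuous_iff_continuousAt.2 fun s => (hasDerivAt_besselEntire n s).continuousAt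

theorem differentiable_besselEntire (n : ℕ) : Differentiable ℂ (besselEntire n) :=
  fun s => (hasDerivAt_besselEntire n s).differentiableAt

/-- The Bessel equation in the form of a three-term recursion. -/
theorem besselEntire_recursion (n : ℕ) (s : ℂ) :
    besselEntire n s = (n + 1) * besselEntire (n + 1) s + s * besselEntire (n + 2) s / 4 := by
  have h2 := (entireCoeff_besselCoeff (n + 2)).summable s
  have h1 := (entireCoeff_besselCoeff (n + 1)).summable s
  have h0 := (entireCoeff_besselCoeff n).summable s
  have e2 : s * besselEntire (n + 2) s / 4
      = ∑' m : ℕ, s * ((besselCoeff (n + 2) m : ℂ) * s ^ m) / 4 := by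
    rw [besselEntire, ← tsum_mul_left, ← tsum_div_const]
  have e1 : ((n : ℂ) + 1) * besselEntire (n + 1) s
      = ((n : ℂ) + 1) * ((besselCoeff (n + 1) 0 : ℂ) * s ^ 0)
        + ∑' m : ℕ, ((n : ℂ) + 1) * ((besselCoeff (n + 1) (m + 1) : ℂ) * s ^ (m + 1)) := by
    rw [besselEntire, h1.tsum_eq_zero_add, mul_add, ← tsum_mul_left]
  rw [e2, e1, besselEntire, h0.tsum_eq_zero_add, add_assoc,
    ← Summable.tsum_add (((summable_nat_add_iff 1).2 h1).mul_left _) ((h2.mul_left s).div_const 4)]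
  congr 1
  · simp only [besselCoeff, zero_add, pow_zero, Nat.factorial_zero, Nat.factorial_succ]
    push_cast
    have : (n : ℂ) + 1 ≠ 0 := Nat.cast_add_one_ne_zero n
    have : (n.factorial : ℂ) ≠ 0 := by exact_mod_cast n.factorial_ne_zero
    field_simp
  · refine tsum_congr fun m => ?_
    have : besselCoeff n (m + 1)
        = (n + 1) * besselCoeff (n + 1) (m + 1) + besselCoeff (n + 2) m / 4 := by
      unfold besselCoeff
      rw [show m + (n + 2) = m + 1 + n + 1 by ring, show m + 1 + (n + 1) = m + 1 + n + 1 by ring,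
        Nat.factorial_succ m, Nat.factorial_succ (m + 1 + n)]
      push_cast
      have : (m : ℝ) + 1 ≠ 0 := by positivity
      have : (m : ℝ) + 1 + n + 1 ≠ 0 := by positivity
      field_simp
      ring
    rw [this]
    push_cast
    ring

theorem besselEntire_conj (n : ℕ) (s : ℂ) :
    besselEntire n (starRingEnd ℂ s) = starRingEnd ℂ (besselEntire n s) := by
  rw [besselEntire, besselEntire, Complex.conj_tsum]
  simp

theorem besselEntire_ofReal (n : ℕ) (x : ℝ) :
    besselEntire n x = ((∑' m : ℕ, besselCoeff n m * x ^ m : ℝ) : ℂ) := by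
  rw [besselEntire, Complex.ofReal_tsum]
  simp

theorem besselEntire_pos {x : ℝ} (n : ℕ) (hx : 0 ≤ x) : 0 < (besselEntire n x).re := by
  rw [besselEntire_ofReal, Complex.ofReal_re]
  have hs : Summable fun m : ℕ => besselCoeff n m * x ^ m := by
    have := (entireCoeff_besselCoeff n) x
    refine this.congr fun m => ?_
    rw [Complex.norm_real, Real.norm_of_nonneg (besselCoeff_pos n m).le]
  exact hs.tsum_pos (fun m => mul_nonneg (besselCoeff_pos n m).le (pow_nonneg hx m)) 0
    (by simpa using besselCoeff_pos n 0)

/-! ### The radial equation -/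

/-- The solution `φ_z(r) = r^n E_n(-z r²)`, regular at the origin, of the radial equation
`r (r φ')' = (n² - z r²) φ`. -/
noncomputable def radial (n : ℕ) (z : ℂ) (r : ℝ) : ℂ :=
  (r : ℂ) ^ n * besselEntire n (-z * (r : ℂ) ^ 2)

/-- The derivative of `radial` in the radial variable. -/
noncomputable def radialDeriv (n : ℕ) (z : ℂ) (r : ℝ) : ℂ :=
  n * (r : ℂ) ^ (n - 1) * besselEntire n (-z * (r : ℂ) ^ 2)
    - z * (r : ℂ) ^ (n + 1) / 2 * besselEntire (n + 1) (-z * (r : ℂ) ^ 2)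

/-- The flux `r φ_z'(r)`. -/
noncomputable def radialFlux (n : ℕ) (z : ℂ) (r : ℝ) : ℂ :=
  (r : ℂ) ^ n * (n * besselEntire n (-z * (r : ℂ) ^ 2)
    - z * (r : ℂ) ^ 2 / 2 * besselEntire (n + 1) (-z * (r : ℂ) ^ 2))

theorem radialFlux_eq (n : ℕ) (z : ℂ) (r : ℝ) : radialFlux n z r = r * radialDeriv n z r := by
  unfold radialFlux radialDeriv
  cases n with
  | zero => simp; ring
  | succ n => simp only [Nat.add_sub_cancel]; ring

theorem hasDerivAt_besselEntire_comp (n : ℕ) (z : ℂ) (r : ℝ) :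
    HasDerivAt (fun r : ℝ => besselEntire n (-z * (r : ℂ) ^ 2))
      (besselEntire (n + 1) (-z * (r : ℂ) ^ 2) / 4 * (-z * (2 * r))) r := by
  have h1 : HasDerivAt (fun w : ℂ => -z * w ^ 2) (-z * (2 * (r : ℂ))) (r : ℂ) := by
    simpa using (hasDerivAt_pow 2 (r : ℂ)).const_mul (-z)
  exact ((hasDerivAt_besselEntire n (-z * (r : ℂ) ^ 2)).comp (r : ℂ) h1).comp_ofReal

theorem hasDerivAt_ofReal_pow (n : ℕ) (r : ℝ) :
    HasDerivAt (fun r : ℝ => (r : ℂ) ^ n) (n * (r : ℂ) ^ (n - 1)) r :=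
  (hasDerivAt_pow n (r : ℂ)).comp_ofReal

theorem hasDerivAt_radial (n : ℕ) (z : ℂ) (r : ℝ) :
    HasDerivAt (radial n z) (radialDeriv n z r) r := by
  refine ((hasDerivAt_ofReal_pow n r).mul (hasDerivAt_besselEntire_comp n z r)).congr_deriv ?_
  unfold radialDeriv
  ring

theorem hasDerivAt_radialFlux (n : ℕ) (z : ℂ) (r : ℝ) :
    HasDerivAt (radialFlux n z)
      ((n ^ 2 * (r : ℂ) ^ (n - 1) - z * (r : ℂ) ^ (n + 1)) * besselEntire n (-z * (r : ℂ) ^ 2))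
      r := by
  have h0 := hasDerivAt_besselEntire_comp n z r
  have h1 := hasDerivAt_besselEntire_comp (n + 1) z r
  have hq : HasDerivAt (fun r : ℝ => z * (r : ℂ) ^ 2 / 2) (z * (2 * r) / 2) r := by
    simpa using ((hasDerivAt_ofReal_pow 2 r).const_mul z).div_const 2
  refine ((hasDerivAt_ofReal_pow n r).mul
    ((h0.const_mul (n : ℂ)).sub (hq.mul h1))).congr_deriv ?_
  simp only [Pi.sub_apply, Pi.mul_apply]
  rw [besselEntire_recursion n (-z * (r : ℂ) ^ 2)]
  cases n with
  | zero => simp; ring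
  | succ n => simp only [Nat.add_sub_cancel]; push_cast; ring

theorem continuous_radial (n : ℕ) (z : ℂ) : Continuous (radial n z) :=
  continuous_iff_continuousAt.2 fun r => (hasDerivAt_radial n z r).continuousAt

theorem continuous_radialDeriv (n : ℕ) (z : ℂ) : Continuous (radialDeriv n z) := by
  have := continuous_besselEntire n
  have := continuous_besselEntire (n + 1)
  unfold radialDeriv
  fun_prop

theorem radialFlux_zero (n : ℕ) (z : ℂ) : radialFlux n z 0 = 0 := by
  simp [radialFlux_eq]

theorem radial_conj (n : ℕ) (z : ℂ) (r : ℝ) :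
    radial n (starRingEnd ℂ z) r = starRingEnd ℂ (radial n z r) := by
  simp [radial, ← besselEntire_conj]

theorem radialFlux_conj (n : ℕ) (z : ℂ) (r : ℝ) :
    radialFlux n (starRingEnd ℂ z) r = starRingEnd ℂ (radialFlux n z r) := by
  simp [radialFlux, ← besselEntire_conj, Complex.conj_ofNat]

/-- **Lagrange's identity** for two solutions of the radial equation. -/
theorem lagrange_identity (n : ℕ) (z w : ℂ) (R : ℝ) :
    (z - w) * ∫ r in (0 : ℝ)..R, (r : ℂ) * (radial n z r * radial n w r)
      = radial n z R * radialFlux n w R - radialFlux n z R * radial n w R := by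
  have hd : ∀ r ∈ Set.uIcc 0 R,
      HasDerivAt (fun r => radial n z r * radialFlux n w r - radialFlux n z r * radial n w r)
        ((z - w) * ((r : ℂ) * (radial n z r * radial n w r))) r := fun r _ => by
    refine (((hasDerivAt_radial n z r).mul (hasDerivAt_radialFlux n w r)).sub
      ((hasDerivAt_radialFlux n z r).mul (hasDerivAt_radial n w r))).congr_deriv ?_
    rw [radialFlux_eq, radialFlux_eq]
    unfold radial
    ring
  have hc : Continuous fun r : ℝ => (z - w) * ((r : ℂ) * (radial n z r * radial n w r)) := by
    have := continuous_radial n z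
    have := continuous_radial n w
    fun_prop
  have := intervalIntegral.integral_eq_sub_of_hasDerivAt hd (hc.intervalIntegrable 0 R)
  rw [intervalIntegral.integral_const_mul] at this
  rw [this, radialFlux_zero, radialFlux_zero]
  ring

/-- The squared weighted norm `∫_0^R r |φ_z(r)|² dr`. -/
noncomputable def radialNormSq (n : ℕ) (R : ℝ) (z : ℂ) : ℝ :=
  ∫ r in (0 : ℝ)..R, r * ‖radial n z r‖ ^ 2

theorem radialNormSq_nonneg (n : ℕ) {R : ℝ} (hR : 0 < R) (z : ℂ) : 0 ≤ radialNormSq n R z :=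
  intervalIntegral.integral_nonneg hR.le fun r hr => mul_nonneg hr.1 (by positivity)

theorem radialNormSq_pos (n : ℕ) {R : ℝ} (hR : 0 < R) (z : ℂ) : 0 < radialNormSq n R z := by
  have hc := continuous_radial n z
  have hE := continuous_besselEntire n
  -- `E_n(-z r²)` does not vanish for small `r`, as `E_n(0) > 0`
  have h0 : ∀ᶠ r : ℝ in nhds 0, besselEntire n (-z * (r : ℂ) ^ 2) ≠ 0 := by
    have : ContinuousAt (fun r : ℝ => besselEntire n (-z * (r : ℂ) ^ 2)) 0 := by
      apply Continuous.continuousAt; fun_prop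
    apply this.eventually_ne
    intro h
    have := besselEntire_pos n (le_refl (0 : ℝ))
    simp at h
    simp [h] at this
  obtain ⟨ε, hε, hε'⟩ := Metric.eventually_nhds_iff.1 h0
  set c := min (ε / 2) R
  have hc0 : 0 < c := lt_min (by linarith) hR
  have hcε : c < ε := (min_le_left _ _).trans_lt (by linarith)
  unfold radialNormSq
  refine intervalIntegral.integral_pos hR (by fun_prop)
    (fun r hr => mul_nonneg hr.1.le (by positivity)) ⟨c, ⟨hc0.le, min_le_right _ _⟩, ?_⟩
  have h1 : besselEntire n (-z * (c : ℂ) ^ 2) ≠ 0 := hε' (by simpa [abs_of_pos hc0] using hcε)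
  have h2 : radial n z c ≠ 0 := by
    unfold radial
    exact mul_ne_zero (pow_ne_zero _ (by exact_mod_cast hc0.ne')) h1
  positivity

theorem ofReal_radialNormSq (n : ℕ) (R : ℝ) (z : ℂ) :
    (radialNormSq n R z : ℂ)
      = ∫ r in (0 : ℝ)..R, (r : ℂ) * (radial n z r * radial n (starRingEnd ℂ z) r) := by
  rw [radialNormSq, ← intervalIntegral.integral_ofReal]
  congr 1 with r
  rw [radial_conj, Complex.mul_conj, Complex.normSq_eq_norm_sq]
  push_cast
  ring

/-- Lagrange's identity for the parameters `z` and `z̄`. -/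
theorem abs_im_mul_radialNormSq_le (n : ℕ) {R : ℝ} (hR : 0 < R) (z : ℂ) :
    |z.im| * radialNormSq n R z ≤ ‖radial n z R‖ * ‖radialFlux n z R‖ := by
  have h := lagrange_identity n z (starRingEnd ℂ z) R
  rw [← ofReal_radialNormSq, Complex.sub_conj] at h
  have h2 := congrArg norm h
  rw [norm_mul, norm_mul, Complex.norm_I, mul_one, Complex.norm_real, Complex.norm_real,
    Real.norm_eq_abs, Real.norm_eq_abs, abs_of_nonneg (radialNormSq_nonneg n hR z), abs_mul] at h2
  have h3 : ‖radial n z R * radialFlux n (starRingEnd ℂ z) R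
      - radialFlux n z R * radial n (starRingEnd ℂ z) R‖
      ≤ 2 * (‖radial n z R‖ * ‖radialFlux n z R‖) := by
    refine (norm_sub_le _ _).trans ?_
    rw [norm_mul, norm_mul, radial_conj, radialFlux_conj, Complex.norm_conj, Complex.norm_conj]
    linarith [mul_comm ‖radial n z R‖ ‖radialFlux n z R‖]
  rw [abs_of_pos (by norm_num : (0 : ℝ) < 2)] at h2
  linarith

theorem radialDeriv_conj (n : ℕ) (z : ℂ) (r : ℝ) :
    radialDeriv n (starRingEnd ℂ z) r = starRingEnd ℂ (radialDeriv n z r) := by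
  simp [radialDeriv, ← besselEntire_conj, Complex.conj_ofNat]

theorem continuous_radialFlux (n : ℕ) (z : ℂ) : Continuous (radialFlux n z) :=
  continuous_iff_continuousAt.2 fun r => (hasDerivAt_radialFlux n z r).continuousAt

/-- A lower bound for `Re (φ̄ (r φ')')`: by the radial equation it is the real part of
`n² |φ|² / r - z r |φ|²`, and the first term is nonnegative. -/
theorem neg_re_mul_le_re_conj_radial_mul_deriv (n : ℕ) (z : ℂ) {r : ℝ} (hr : 0 ≤ r) :
    -z.re * (r * ‖radial n z r‖ ^ 2) ≤ (starRingEnd ℂ (radial n z r) *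
      ((n ^ 2 * (r : ℂ) ^ (n - 1) - z * (r : ℂ) ^ (n + 1))
        * besselEntire n (-z * (r : ℂ) ^ 2))).re := by
  rcases hr.eq_or_lt with h0 | h0
  · subst h0
    cases n with
    | zero => simp
    | succ k =>
      have : radial (k + 1) z 0 = 0 := by simp [radial]
      rw [this]; simp
  · have hrc : (r : ℂ) ≠ 0 := by exact_mod_cast h0.ne'
    set p := radial n z r with hp
    have : (n ^ 2 * (r : ℂ) ^ (n - 1) - z * (r : ℂ) ^ (n + 1))
        * besselEntire n (-z * (r : ℂ) ^ 2) = ((n ^ 2 / r : ℝ) : ℂ) * p - z * r * p := by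
      rw [hp]
      unfold radial
      cases n with
      | zero => simp
      | succ k =>
        simp only [Nat.add_sub_cancel]; push_cast; field_simp; ring
    rw [this, mul_sub, mul_left_comm (starRingEnd ℂ p), Complex.conj_mul',
      show starRingEnd ℂ p * (z * r * p) = z * ((r * ‖p‖ ^ 2 : ℝ) : ℂ) by
        push_cast; rw [← Complex.conj_mul']; ring, Complex.sub_re, Complex.re_mul_ofReal]
    have h3 : (((n ^ 2 / r : ℝ) : ℂ) * (‖p‖ : ℂ) ^ 2).re = n ^ 2 / r * ‖p‖ ^ 2 := by
      norm_cast
    have h4 : 0 ≤ (n : ℝ) ^ 2 / r * ‖p‖ ^ 2 := by positivity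
    rw [h3]; linarith

theorem re_conj_mul_add_le (p q : ℂ) {r R : ℝ} (hr : 0 ≤ r) (hrR : r ≤ R) :
    ((r : ℂ) ^ 2 * (starRingEnd ℂ q * p + starRingEnd ℂ p * q)).re
      ≤ r * (R ^ 2 * ‖p‖ ^ 2 + ‖q‖ ^ 2) := by
  have e4 : ((r : ℂ) ^ 2 * (starRingEnd ℂ q * p + starRingEnd ℂ p * q)).re
      ≤ r ^ 2 * (2 * (‖p‖ * ‖q‖)) := by
    rw [← Complex.ofReal_pow, Complex.re_ofReal_mul, Complex.add_re]
    have h1 : (starRingEnd ℂ q * p).re ≤ ‖p‖ * ‖q‖ := by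
      refine (Complex.re_le_norm _).trans ?_
      rw [norm_mul, Complex.norm_conj, mul_comm]
    have h2 : (starRingEnd ℂ p * q).re ≤ ‖p‖ * ‖q‖ := by
      refine (Complex.re_le_norm _).trans ?_
      rw [norm_mul, Complex.norm_conj]
    exact mul_le_mul_of_nonneg_left (by linarith) (sq_nonneg r)
  have h1 : 2 * ((r * ‖p‖) * ‖q‖) ≤ (r * ‖p‖) ^ 2 + ‖q‖ ^ 2 := by
    linarith [two_mul_le_add_sq (r * ‖p‖) ‖q‖]
  have h2 : (r * ‖p‖) ^ 2 ≤ R ^ 2 * ‖p‖ ^ 2 := by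
    rw [mul_pow]; gcongr
  calc _ ≤ r ^ 2 * (2 * (‖p‖ * ‖q‖)) := e4
    _ = r * (2 * ((r * ‖p‖) * ‖q‖)) := by ring
    _ ≤ _ := mul_le_mul_of_nonneg_left (by linarith) hr

/-- The trace inequality combined with the energy identity: the boundary value `φ_z(R)` is
controlled by the weighted norm of `φ_z` and the boundary flux. -/
theorem sq_mul_norm_radial_le (n : ℕ) {R : ℝ} (hR : 0 < R) (z : ℂ) :
    R ^ 2 * ‖radial n z R‖ ^ 2
      ≤ (2 + R ^ 2 + ‖z‖) * radialNormSq n R z + ‖radial n z R‖ * ‖radialFlux n z R‖ := by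
  have hre : ∀ (f : ℝ → ℂ) (f' : ℂ) (r : ℝ), HasDerivAt f f' r →
      HasDerivAt (fun r => (f r).re) f'.re r := fun f f' r h =>
    Complex.reCLM.hasFDerivAt.comp_hasDerivAt r h
  set w := starRingEnd ℂ z with hw
  have hc := continuous_radial n z
  have hcd := continuous_radialDeriv n z
  have hcw := continuous_radial n w
  have hcdw := continuous_radialDeriv n w
  have hcf := continuous_radialFlux n z
  have hE := continuous_besselEntire n
  -- the derivative of `r² |φ|² - φ̄ r φ'`
  set S' : ℝ → ℂ := fun r =>
    (2 * (r : ℂ) * (radial n w r * radial n z r)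
      + (r : ℂ) ^ 2 * (radialDeriv n w r * radial n z r + radial n w r * radialDeriv n z r))
    - (radialDeriv n w r * radialFlux n z r + radial n w r *
      ((n ^ 2 * (r : ℂ) ^ (n - 1) - z * (r : ℂ) ^ (n + 1))
        * besselEntire n (-z * (r : ℂ) ^ 2))) with hS'
  have hd : ∀ r ∈ Set.uIcc 0 R, HasDerivAt
      (fun r : ℝ => ((r : ℂ) ^ 2 * (radial n w r * radial n z r)
        - radial n w r * radialFlux n z r).re) (S' r).re r := fun r _ => by
    refine hre _ _ _ ((((hasDerivAt_ofReal_pow 2 r).mul ((hasDerivAt_radial n w r).mul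
      (hasDerivAt_radial n z r))).sub
      ((hasDerivAt_radial n w r).mul (hasDerivAt_radialFlux n z r))).congr_deriv ?_)
    simp [hS']
  have hcS : Continuous fun r => (S' r).re :=
    Complex.continuous_re.comp (by rw [hS']; fun_prop)
  have hint := intervalIntegral.integral_eq_sub_of_hasDerivAt hd (hcS.intervalIntegrable 0 R)
  have hTR : R ^ 2 * ‖radial n z R‖ ^ 2 - ‖radial n z R‖ * ‖radialFlux n z R‖
      ≤ ((R : ℂ) ^ 2 * (radial n w R * radial n z R) - radial n w R * radialFlux n z R).re := by
    rw [hw, radial_conj, Complex.sub_re]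
    have h1 : (starRingEnd ℂ (radial n z R) * radialFlux n z R).re
        ≤ ‖radial n z R‖ * ‖radialFlux n z R‖ := by
      refine (Complex.re_le_norm _).trans ?_
      rw [norm_mul, Complex.norm_conj]
    have h2 : ((R : ℂ) ^ 2 * (starRingEnd ℂ (radial n z R) * radial n z R)).re
        = R ^ 2 * ‖radial n z R‖ ^ 2 := by
      rw [Complex.conj_mul']
      norm_cast
    rw [h2]; linarith
  have hle : ∫ r in (0 : ℝ)..R, (S' r).re
      ≤ ∫ r in (0 : ℝ)..R, (2 + R ^ 2 + ‖z‖) * (r * ‖radial n z r‖ ^ 2) := by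
    refine intervalIntegral.integral_mono_on hR.le (hcS.intervalIntegrable 0 R)
      (Continuous.intervalIntegrable (by fun_prop) 0 R) fun r hr => ?_
    have e1 := neg_re_mul_le_re_conj_radial_mul_deriv n z hr.1
    have e4 := re_conj_mul_add_le (radial n z r) (radialDeriv n z r) hr.1 hr.2
    have e2 : (starRingEnd ℂ (radialDeriv n z r) * radialFlux n z r).re
        = r * ‖radialDeriv n z r‖ ^ 2 := by
      rw [radialFlux_eq, mul_left_comm, Complex.conj_mul']; norm_cast
    have e3 : (2 * (r : ℂ) * (starRingEnd ℂ (radial n z r) * radial n z r)).re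
        = 2 * r * ‖radial n z r‖ ^ 2 := by
      rw [Complex.conj_mul']; norm_cast
    have e6 : z.re * (r * ‖radial n z r‖ ^ 2) ≤ ‖z‖ * (r * ‖radial n z r‖ ^ 2) :=
      mul_le_mul_of_nonneg_right (Complex.re_le_norm z) (mul_nonneg hr.1 (by positivity))
    simp only [hS', hw, radial_conj, radialDeriv_conj]
    rw [Complex.sub_re, Complex.add_re,
      Complex.add_re (starRingEnd ℂ (radialDeriv n z r) * radialFlux n z r), e2, e3]
    linarith
  rw [intervalIntegral.integral_const_mul, hint] at hle
  rw [radialFlux_zero] at hle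
  unfold radialNormSq
  simp only [Complex.ofReal_zero, ne_eq, OfNat.ofNat_ne_zero, not_false_eq_true, zero_pow,
    zero_mul, mul_zero, sub_zero, Complex.zero_re] at hle
  linarith

/-- The key estimate: away from the real axis, the flux through the boundary controls the norm
of `φ_z`. -/
theorem abs_im_sq_mul_radialNormSq_le (n : ℕ) {R : ℝ} (hR : 0 < R) (z : ℂ) :
    (R * |z.im|) ^ 2 * radialNormSq n R z
      ≤ (2 + R ^ 2 + 2 * ‖z‖) * ‖radialFlux n z R‖ ^ 2 := by
  have h1 := abs_im_mul_radialNormSq_le n hR z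
  have h2 := sq_mul_norm_radial_le n hR z
  have h0 := radialNormSq_nonneg n hR z
  have hy : |z.im| ≤ ‖z‖ := Complex.abs_im_le_norm z
  set a := radialNormSq n R z
  set b := ‖radial n z R‖
  set c := ‖radialFlux n z R‖
  set y := |z.im|
  have hy0 : 0 ≤ y := abs_nonneg _
  have hb : 0 ≤ b := norm_nonneg _
  have hc : 0 ≤ c := norm_nonneg _
  -- multiply the trace inequality `h2` by `y` and use `h1` to eliminate `a`
  have h3 : R ^ 2 * y * b * b ≤ (2 + R ^ 2 + 2 * ‖z‖) * c * b := by
    have e1 : y * (R ^ 2 * b ^ 2) ≤ y * ((2 + R ^ 2 + ‖z‖) * a + b * c) :=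
      mul_le_mul_of_nonneg_left h2 hy0
    have e2 : (2 + R ^ 2 + ‖z‖) * (y * a) ≤ (2 + R ^ 2 + ‖z‖) * (b * c) :=
      mul_le_mul_of_nonneg_left h1 (by positivity)
    have e3 : y * (b * c) ≤ ‖z‖ * (b * c) := mul_le_mul_of_nonneg_right hy (by positivity)
    nlinarith
  have h4 : R ^ 2 * y * b ≤ (2 + R ^ 2 + 2 * ‖z‖) * c := by
    rcases hb.eq_or_lt with h | h
    · rw [← h, mul_zero]; positivity
    · exact le_of_mul_le_mul_right h3 h
  calc (R * y) ^ 2 * a = R ^ 2 * y * (y * a) := by ring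
    _ ≤ R ^ 2 * y * (b * c) := by gcongr
    _ = (R ^ 2 * y * b) * c := by ring
    _ ≤ ((2 + R ^ 2 + 2 * ‖z‖) * c) * c := by gcongr
    _ = _ := by ring

/-! ### Entire quotients that are small off the real axis -/

/-- An entire function bounded by `C √(1 + |z|) / |Im z|` vanishes: apply the maximum principle
to `(z² - r²) H(z)` on the disk of radius `r`, using `|z² - r²| = 2 r |Im z|` for `|z| = r`. -/
theorem eq_zero_of_norm_mul_abs_im_le {H : ℂ → ℂ} (hH : Differentiable ℂ H) {C : ℝ}
    (h : ∀ z, ‖H z‖ * |z.im| ≤ C * √(1 + ‖z‖)) (w : ℂ) : H w = 0 := by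
  have hC : 0 ≤ C := by simpa using h 0
  by_contra hw
  have hpos : 0 < ‖H w‖ := norm_pos_iff.2 hw
  -- the radius is so large that `r² - |w|² ≥ r² / 2` and that the bound on the circle contradicts
  -- `H w ≠ 0`
  set r : ℝ := 1 + 2 * ‖w‖ + 32 * C ^ 2 / ‖H w‖ ^ 2 with hr
  have hr1 : 1 + 2 * ‖w‖ ≤ r := le_add_of_nonneg_right (by positivity)
  have hw0 := norm_nonneg w
  have hr0 : 0 < r := by linarith
  have hbd : ∀ z ∈ frontier (Metric.ball (0 : ℂ) r),
      ‖(z ^ 2 - (r : ℂ) ^ 2) * H z‖ ≤ 2 * r * (C * √(1 + r)) := by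
    intro z hz
    rw [frontier_ball _ hr0.ne', mem_sphere_zero_iff_norm] at hz
    have h1 : (z ^ 2 - (r : ℂ) ^ 2) = z * (z - starRingEnd ℂ z) := by
      rw [← hz, ← Complex.mul_conj']; ring
    have h2 : ‖z ^ 2 - (r : ℂ) ^ 2‖ = 2 * r * |z.im| := by
      rw [h1, norm_mul, hz, Complex.sub_conj, norm_mul, Complex.norm_I, Complex.norm_real,
        Real.norm_eq_abs, abs_mul, abs_of_pos (by norm_num : (0 : ℝ) < 2)]
      ring
    have h3 := h z
    rw [hz] at h3
    rw [norm_mul, h2]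
    calc 2 * r * |z.im| * ‖H z‖ = 2 * r * (‖H z‖ * |z.im|) := by ring
      _ ≤ _ := by gcongr
  have hd : Differentiable ℂ fun z : ℂ => (z ^ 2 - (r : ℂ) ^ 2) * H z := by fun_prop
  have hmax := Complex.norm_le_of_forall_mem_frontier_norm_le Metric.isBounded_ball
    hd.diffContOnCl hbd (z := w)
    (subset_closure (by rw [mem_ball_zero_iff]; linarith))
  rw [norm_mul] at hmax
  have hlow : r ^ 2 / 2 ≤ ‖w ^ 2 - (r : ℂ) ^ 2‖ := by
    have h1 := norm_sub_norm_le ((r : ℂ) ^ 2) (w ^ 2)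
    rw [norm_sub_rev, norm_pow, norm_pow, Complex.norm_real, Real.norm_of_nonneg hr0.le] at h1
    nlinarith
  have h4 : r ^ 2 / 2 * ‖H w‖ ≤ 2 * r * (C * √(1 + r)) :=
    (mul_le_mul_of_nonneg_right hlow hpos.le).trans hmax
  have h5 : r * ‖H w‖ ≤ 4 * C * √(1 + r) := by
    have : r * (r * ‖H w‖) ≤ r * (4 * C * √(1 + r)) := by linarith
    exact le_of_mul_le_mul_left this hr0
  have h6 : (r * ‖H w‖) ^ 2 ≤ (4 * C * √(1 + r)) ^ 2 := by gcongr
  rw [mul_pow, mul_pow (4 * C), Real.sq_sqrt (by linarith)] at h6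
  have h7 : (r * ‖H w‖ ^ 2) * r ≤ 32 * C ^ 2 * r := by
    have : (4 * C) ^ 2 * (1 + r) ≤ (4 * C) ^ 2 * (2 * r) := by gcongr; linarith
    linarith
  have h8 : r * ‖H w‖ ^ 2 ≤ 32 * C ^ 2 := le_of_mul_le_mul_right h7 hr0
  have h9 : r * ‖H w‖ ^ 2 = (1 + 2 * ‖w‖) * ‖H w‖ ^ 2 + 32 * C ^ 2 := by
    rw [hr]; field_simp
  have : 0 < (1 + 2 * ‖w‖) * ‖H w‖ ^ 2 := by positivity
  linarith

/-- If `F` vanishes at the zeros of `g`, which are simple, then `F / g` extends to an entire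
function. -/
theorem exists_differentiable_mul_eq {F g : ℂ → ℂ} (hF : Differentiable ℂ F)
    (hg : Differentiable ℂ g) (hz : ∀ z, g z = 0 → deriv g z ≠ 0 ∧ F z = 0) :
    ∃ H : ℂ → ℂ, Differentiable ℂ H ∧ ∀ z, F z = H z * g z := by
  classical
  refine ⟨fun z => if g z = 0 then deriv F z / deriv g z else F z / g z, fun z₀ => ?_,
    fun z => ?_⟩
  · by_cases h0 : g z₀ = 0
    · obtain ⟨h1, h2⟩ := hz z₀ h0
      have dF : DifferentiableAt ℂ (dslope F z₀) z₀ :=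
        (((Complex.differentiableOn_dslope Filter.univ_mem).2 hF.differentiableOn) z₀
          trivial).differentiableAt Filter.univ_mem
      have dg : DifferentiableAt ℂ (dslope g z₀) z₀ :=
        (((Complex.differentiableOn_dslope Filter.univ_mem).2 hg.differentiableOn) z₀
          trivial).differentiableAt Filter.univ_mem
      have hne : dslope g z₀ z₀ ≠ 0 := by rwa [dslope_same]
      refine (dF.div dg hne).congr_of_eventuallyEq ?_
      filter_upwards [dg.continuousAt.eventually_ne hne] with z hz'
      by_cases hzz : z = z₀
      · subst hzz
        simp [h0, dslope_same]
      · have hsub : z - z₀ ≠ 0 := sub_ne_zero.2 hzz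
        have eF : F z = (z - z₀) * dslope F z₀ z := by
          rw [← smul_eq_mul, sub_smul_dslope, h2, sub_zero]
        have eg : g z = (z - z₀) * dslope g z₀ z := by
          rw [← smul_eq_mul, sub_smul_dslope, h0, sub_zero]
        have : g z ≠ 0 := by rw [eg]; exact mul_ne_zero hsub hz'
        rw [if_neg this, Pi.div_apply, eF, eg, mul_div_mul_left _ _ hsub]
    · refine ((hF z₀).div (hg z₀) h0).congr_of_eventuallyEq ?_
      filter_upwards [(hg z₀).continuousAt.eventually_ne h0] with z hz'
      rw [if_neg hz', Pi.div_apply]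
  · by_cases h0 : g z = 0
    · simp [h0, (hz z h0).2]
    · simp [h0]

/-- The form in which `eq_zero_of_norm_mul_abs_im_le` is applied to the quotient `F / g`. -/
theorem eq_zero_of_norm_mul_abs_im_le_mul {F g : ℂ → ℂ} (hF : Differentiable ℂ F)
    (hg : Differentiable ℂ g) (hz : ∀ z, g z = 0 → deriv g z ≠ 0 ∧ F z = 0)
    (him : ∀ z, g z = 0 → z.im = 0) {C : ℝ} (hC : 0 ≤ C)
    (h : ∀ z, ‖F z‖ * |z.im| ≤ C * √(1 + ‖z‖) * ‖g z‖) (z : ℂ) : F z = 0 := by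
  obtain ⟨H, hH, hFH⟩ := exists_differentiable_mul_eq hF hg hz
  rw [hFH, eq_zero_of_norm_mul_abs_im_le hH (C := C) (fun w => ?_) z, zero_mul]
  by_cases h0 : g w = 0
  · rw [him w h0, abs_zero, mul_zero]; positivity
  · have h1 := h w
    rw [hFH, norm_mul] at h1
    refine le_of_mul_le_mul_right ?_ (norm_pos_iff.2 h0)
    linarith

/-! ### The zeros of the boundary flux -/

theorem differentiable_radialFlux (n : ℕ) (R : ℝ) :
    Differentiable ℂ fun z => radialFlux n z R := by
  have := differentiable_besselEntire n
  have := differentiable_besselEntire (n + 1)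
  unfold radialFlux
  fun_prop

theorem im_eq_zero_of_radialFlux_eq_zero {n : ℕ} {R : ℝ} (hR : 0 < R) {z : ℂ}
    (h : radialFlux n z R = 0) : z.im = 0 := by
  have h1 := abs_im_sq_mul_radialNormSq_le n hR z
  rw [h, norm_zero] at h1
  have h2 := radialNormSq_pos n hR z
  by_contra h3
  have : 0 < |z.im| := abs_pos.2 h3
  have : 0 < (R * |z.im|) ^ 2 * radialNormSq n R z := by positivity
  linarith

/-- For real `z < 0` all terms of the series in the flux are nonnegative, and some are positive. -/
theorem re_nonneg_of_radialFlux_eq_zero {n : ℕ} {R : ℝ} (hR : 0 < R) {z : ℂ}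
    (h : radialFlux n z R = 0) : 0 ≤ z.re := by
  have him := im_eq_zero_of_radialFlux_eq_zero hR h
  by_contra! hneg
  obtain ⟨x, rfl⟩ : ∃ x : ℝ, z = x := ⟨z.re, Complex.ext rfl (by simp [him])⟩
  rw [Complex.ofReal_re] at hneg
  have hs : 0 ≤ -x * R ^ 2 := by nlinarith [sq_nonneg R]
  have hs' : 0 < -x * R ^ 2 := mul_pos (by linarith) (by positivity)
  have e0 := besselEntire_pos n hs
  have e1 := besselEntire_pos (n + 1) hs
  rw [radialFlux, show (-(x : ℂ) * (R : ℂ) ^ 2) = ((-x * R ^ 2 : ℝ) : ℂ) by push_cast; ring,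
    mul_eq_zero] at h
  have h := congrArg Complex.re (h.resolve_left (pow_ne_zero _ (by exact_mod_cast hR.ne')))
  rw [show (x : ℂ) * (R : ℂ) ^ 2 / 2 = ((x * R ^ 2 / 2 : ℝ) : ℂ) by push_cast; ring,
    Complex.sub_re, Complex.re_ofReal_mul, ← Complex.ofReal_natCast, Complex.re_ofReal_mul,
    Complex.zero_re] at h
  have p0 : 0 ≤ (n : ℝ) * (besselEntire n ((-x * R ^ 2 : ℝ) : ℂ)).re := by positivity
  have p1 := mul_pos hs' e1
  nlinarith

theorem radialFlux_param_zero {n : ℕ} {R : ℝ} (hR : 0 < R) :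
    radialFlux n 0 R = 0 ↔ n = 0 := by
  have e0 := besselEntire_pos n (le_refl (0 : ℝ))
  have : besselEntire n 0 ≠ 0 := fun h => by simp [h] at e0
  simp only [radialFlux, neg_zero, zero_mul, zero_div, sub_zero, mul_eq_zero, this, or_false,
    Nat.cast_eq_zero, pow_eq_zero_iff', Complex.ofReal_eq_zero, hR.ne', false_and, false_or]

/-- The zeros of the flux are simple: at a zero `z`, Lagrange's identity reads
`(z - w) ∫ r φ_z φ_w dr = φ_z(R) g(w)`, and dividing by `z - w` and letting `w → z` gives
`∫ r φ_z² dr = -φ_z(R) g'(z)`, where the left side is positive because `z` is real. -/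
theorem deriv_radialFlux_ne_zero {n : ℕ} {R : ℝ} (hR : 0 < R) {z : ℂ}
    (h : radialFlux n z R = 0) : deriv (fun z => radialFlux n z R) z ≠ 0 := by
  intro hd
  have him := im_eq_zero_of_radialFlux_eq_zero hR h
  set I : ℂ → ℂ := fun w => ∫ r in (0 : ℝ)..R, (r : ℂ) * (radial n z r * radial n w r)
  have hI : Continuous I := by
    refine intervalIntegral.continuous_parametric_intervalIntegral_of_continuous' ?_ 0 R
    have := continuous_radial n z
    have := continuous_besselEntire n
    unfold Function.uncurry radial
    fun_prop
  have hslope := (differentiable_radialFlux n R z).hasDerivAt.tendsto_slope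
  rw [hd] at hslope
  have h1 : Filter.Tendsto I (nhdsWithin z {z}ᶜ) (nhds 0) := by
    have := hslope.const_mul (-radial n z R)
    rw [mul_zero] at this
    refine this.congr' ?_
    filter_upwards [self_mem_nhdsWithin] with w hw
    have hw' : w - z ≠ 0 := sub_ne_zero.2 hw
    have hL := lagrange_identity n z w R
    rw [h, zero_mul, sub_zero] at hL
    rw [slope_def_field, h, sub_zero, ← mul_div_assoc, div_eq_iff hw', neg_mul, ← hL]
    ring
  have h2 : I z = 0 := tendsto_nhds_unique
    ((hI.tendsto z).mono_left nhdsWithin_le_nhds) h1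
  have h3 := ofReal_radialNormSq n R z
  rw [Complex.conj_eq_iff_im.2 him] at h3
  have h4 := radialNormSq_pos n hR z
  have : (radialNormSq n R z : ℂ) = 0 := h3.trans h2
  exact h4.ne' (by exact_mod_cast this)

/-! ### Bessel functions in terms of the regular radial solution -/

/-- The real factor `±(k / 2)^|ν|` that relates `J_ν(k r)` to `φ_{k²}(r)`; the sign is
`(-1)^ν` for `ν < 0`. -/
noncomputable def besselScale (ν : ℤ) (k : ℝ) : ℝ :=
  (if 0 ≤ ν then 1 else (-1) ^ ν.natAbs) * (k / 2) ^ ν.natAbs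

theorem besselScale_ne_zero (ν : ℤ) {k : ℝ} (hk : k ≠ 0) : besselScale ν k ≠ 0 := by
  unfold besselScale
  refine mul_ne_zero ?_ (by positivity)
  split_ifs
  · exact one_ne_zero
  · exact pow_ne_zero _ (by norm_num)

theorem besselJ_natCast (n : ℕ) (x : ℝ) :
    besselJ n x = (x / 2) ^ n * ∑' m : ℕ, besselCoeff n m * (-x ^ 2) ^ m := by
  rw [besselJ, ← tsum_mul_left]
  refine tsum_congr fun m => ?_
  rw [show (m : ℝ) + ((n : ℤ) : ℝ) + 1 = ((m + n : ℕ) : ℝ) + 1 by push_cast; ring,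
    Real.Gamma_nat_eq_factorial,
    show (2 * (m : ℤ) + (n : ℤ)) = ((2 * m + n : ℕ) : ℤ) by push_cast; ring, zpow_natCast,
    besselCoeff, pow_add, pow_mul, show (x / 2) ^ 2 = x ^ 2 / 4 by ring, div_pow, neg_pow (x ^ 2)]
  field_simp

/-- `J_{-n} = (-1)^n J_n`: in the series of `J_{-n}` the terms with `m < n` vanish, since `1 / Γ`
is zero there, and the remaining ones are those of `J_n` shifted by `n`. -/
theorem besselJ_neg_natCast (n : ℕ) (x : ℝ) :
    besselJ (-n) x = (-1) ^ n * besselJ n x := by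
  rw [besselJ, besselJ, ← tsum_mul_left]
  rw [← (add_left_injective n).tsum_eq]
  · refine tsum_congr fun m => ?_
    rw [show (((m + n : ℕ) : ℝ)) + ((-(n : ℤ) : ℤ) : ℝ) + 1 = (m : ℝ) + 1 by push_cast; ring,
      show (m : ℝ) + ((n : ℤ) : ℝ) + 1 = ((m + n : ℕ) : ℝ) + 1 by push_cast; ring,
      Real.Gamma_nat_eq_factorial, Real.Gamma_nat_eq_factorial,
      show (2 * ((m + n : ℕ) : ℤ) + -(n : ℤ)) = 2 * (m : ℤ) + n by push_cast; ring, pow_add]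
    ring
  · intro m hm
    by_contra hlt
    have hmn : m < n := by
      by_contra! hle
      exact hlt ⟨m - n, Nat.sub_add_cancel hle⟩
    refine hm ?_
    obtain ⟨j, rfl⟩ := Nat.exists_eq_add_of_lt hmn
    beta_reduce
    rw [show (m : ℝ) + ((-((m + j + 1 : ℕ) : ℤ) : ℤ) : ℝ) + 1 = -(j : ℝ) by push_cast; ring,
      Real.Gamma_neg_nat_eq_zero]
    simp

theorem besselJ_mul_eq (ν : ℤ) (k r : ℝ) :
    (besselJ ν (k * r) : ℂ) = besselScale ν k * radial ν.natAbs ((k : ℂ) ^ 2) r := by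
  have key : ∀ n : ℕ, (besselJ n (k * r) : ℂ)
      = ((k / 2) ^ n : ℝ) * radial n ((k : ℂ) ^ 2) r := fun n => by
    rw [besselJ_natCast, radial,
      show -(k : ℂ) ^ 2 * (r : ℂ) ^ 2 = ((-(k * r) ^ 2 : ℝ) : ℂ) by push_cast; ring,
      besselEntire_ofReal]
    push_cast
    ring
  obtain ⟨n, rfl | rfl⟩ := Int.eq_nat_or_neg ν
  · rw [key, besselScale, if_pos (Int.natCast_nonneg n), one_mul, Int.natAbs_natCast]
  · rw [besselJ_neg_natCast, Complex.ofReal_mul, key, besselScale, Int.natAbs_neg,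
      Int.natAbs_natCast]
    rcases Nat.eq_zero_or_pos n with rfl | hn
    · simp
    · rw [if_neg (by omega)]
      push_cast
      ring

theorem radialDeriv_sq_im (n : ℕ) (k r : ℝ) : (radialDeriv n ((k : ℂ) ^ 2) r).im = 0 := by
  rw [← Complex.conj_eq_iff_im, ← radialDeriv_conj]
  simp

theorem mul_deriv_besselJ (ν : ℤ) (k r : ℝ) :
    (k : ℂ) * (deriv (besselJ ν) (k * r) : ℝ)
      = besselScale ν k * radialDeriv ν.natAbs ((k : ℂ) ^ 2) r := by
  have h1 : (fun r => besselJ ν (k * r))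
      = fun r => besselScale ν k * (radial ν.natAbs ((k : ℂ) ^ 2) r).re := by
    funext r
    rw [← Complex.re_ofReal_mul, ← besselJ_mul_eq, Complex.ofReal_re]
  have h2 : HasDerivAt (fun r => (radial ν.natAbs ((k : ℂ) ^ 2) r).re)
      (radialDeriv ν.natAbs ((k : ℂ) ^ 2) r).re r :=
    Complex.reCLM.hasFDerivAt.comp_hasDerivAt r (hasDerivAt_radial ν.natAbs ((k : ℂ) ^ 2) r)
  have h3 := deriv_comp_mul_left k (besselJ ν) r
  rw [h1, (h2.const_mul _).deriv, smul_eq_mul] at h3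
  rw [← Complex.ofReal_mul, ← h3]
  apply Complex.ext
  · simp
  · simp [radialDeriv_sq_im]

/-- The wave numbers are the square roots of the zeros of the boundary flux. -/
theorem mem_waveNumbers_iff {R : ℝ} (hR : 0 < R) (ν : ℤ) (k : ℝ) :
    k ∈ waveNumbers R ν ↔ 0 ≤ k ∧ radialFlux ν.natAbs ((k : ℂ) ^ 2) R = 0 := by
  have hRc : (R : ℂ) ≠ 0 := by exact_mod_cast hR.ne'
  rcases eq_or_ne k 0 with rfl | hk
  · have hd : ν = 0 → deriv (besselJ ν) 0 = 0 := by
      rintro rfl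
      have := mul_deriv_besselJ 0 1 0
      simpa [radialDeriv] using this
    simp only [waveNumbers, Set.mem_ofPred_eq, lt_irrefl, true_and, false_or, zero_mul, le_refl,
      Complex.ofReal_zero, ne_eq, OfNat.ofNat_ne_zero, not_false_eq_true, zero_pow,
      radialFlux_param_zero hR, Int.natAbs_eq_zero]
    exact ⟨fun h => h.1, fun h => ⟨h, hd h⟩⟩
  · have h1 := mul_deriv_besselJ ν k R
    have hs : (besselScale ν k : ℂ) ≠ 0 := by exact_mod_cast besselScale_ne_zero ν hk
    have hkc : (k : ℂ) ≠ 0 := by exact_mod_cast hk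
    have h2 : deriv (besselJ ν) (k * R) = 0 ↔ radialFlux ν.natAbs ((k : ℂ) ^ 2) R = 0 := by
      rw [radialFlux_eq, mul_eq_zero_iff_left hRc]
      constructor
      · intro h
        rw [h, Complex.ofReal_zero, mul_zero, zero_eq_mul] at h1
        exact h1.resolve_left hs
      · intro h
        rw [h, mul_zero, mul_eq_zero] at h1
        exact_mod_cast h1.resolve_left hkc
    simp only [waveNumbers, Set.mem_ofPred_eq, hk, false_and, or_false, h2]
    exact and_congr_left fun _ => ⟨le_of_lt, fun h => lt_of_le_of_ne h (Ne.symm hk)⟩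

theorem exists_mem_waveNumbers_of_radialFlux_eq_zero {R : ℝ} (hR : 0 < R) (ν : ℤ) {z : ℂ}
    (h : radialFlux ν.natAbs z R = 0) : ∃ k ∈ waveNumbers R ν, (k : ℂ) ^ 2 = z := by
  have him := im_eq_zero_of_radialFlux_eq_zero hR h
  have hre := re_nonneg_of_radialFlux_eq_zero hR h
  have hz : ((√z.re : ℝ) : ℂ) ^ 2 = z := by
    rw [← Complex.ofReal_pow, Real.sq_sqrt hre]
    exact Complex.ext rfl (by simp [him])
  exact ⟨√z.re, (mem_waveNumbers_iff hR ν _).2 ⟨Real.sqrt_nonneg _, by rwa [hz]⟩, hz⟩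

/-- The wave numbers have no accumulation point, as zeros of an analytic function. -/
theorem waveNumbers_inter_Iic_finite {R : ℝ} (hR : 0 < R) (ν : ℤ) (M : ℝ) :
    (waveNumbers R ν ∩ Set.Iic M).Finite := by
  by_contra hinf
  obtain ⟨x, -, hx⟩ := Set.Infinite.exists_accPt_of_subset_isCompact hinf
    (isCompact_Icc (a := 0) (b := M))
    fun k hk => ⟨((mem_waveNumbers_iff hR ν k).1 hk.1).1, hk.2⟩
  have hd : Differentiable ℂ fun w : ℂ => radialFlux ν.natAbs (w ^ 2) R :=
    (differentiable_radialFlux ν.natAbs R).comp (differentiable_pow 2)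
  have hfreq : ∃ᶠ w in nhdsWithin (x : ℂ) {(x : ℂ)}ᶜ, radialFlux ν.natAbs (w ^ 2) R = 0 := by
    have h1 := accPt_iff_frequently_nhdsNE.1 hx
    have ht : Filter.Tendsto (fun k : ℝ => (k : ℂ)) (nhdsWithin x {x}ᶜ)
        (nhdsWithin (x : ℂ) {(x : ℂ)}ᶜ) := by
      refine tendsto_nhdsWithin_iff.2 ⟨(Complex.continuous_ofReal.tendsto x).mono_left
        nhdsWithin_le_nhds, ?_⟩
      filter_upwards [self_mem_nhdsWithin] with k hk
      simpa using hk
    exact ht.frequently (h1.mono fun k hk => ((mem_waveNumbers_iff hR ν k).1 hk.1).2)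
  have h0 := AnalyticOnNhd.eq_of_frequently_eq
    ((Complex.analyticOnNhd_univ_iff_differentiable).2 hd)
    (analyticOnNhd_const (v := (0 : ℂ))) hfreq
  -- the flux does not vanish at `z = i`
  have h1 : radialFlux ν.natAbs Complex.I R = 0 := by
    have := congrFun h0 (Complex.I ^ (1 / 2 : ℂ))
    simpa [← Complex.cpow_nat_mul] using this
  have := im_eq_zero_of_radialFlux_eq_zero hR h1
  simp at this

/-! ### Integration over the disk -/

instance isFiniteMeasure_diskMeasure (R : ℝ) : IsFiniteMeasure (diskMeasure R) :=
  isFiniteMeasure_restrict.2 measure_ball_lt_top.ne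

theorem ae_norm_lt_diskMeasure (R : ℝ) : ∀ᵐ x ∂diskMeasure R, ‖x‖ < R := by
  filter_upwards [ae_restrict_mem (measurableSet_ball (x := (0 : ℂ)) (ε := R))] with x hx
  simpa using hx

theorem integrable_mul_of_norm_le {R : ℝ} {h g : ℂ → ℂ} (hh : Integrable h (diskMeasure R))
    (hg : Measurable g) {C : ℝ} (hC : ∀ x : ℂ, ‖x‖ < R → ‖g x‖ ≤ C) :
    Integrable (fun x => h x * g x) (diskMeasure R) := by
  refine hh.mul_bdd (c := C) hg.aestronglyMeasurable ?_
  filter_upwards [ae_norm_lt_diskMeasure R] with x hx using hC x hx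

/-- The angular factor `e^{iνθ}`, as a function on the plane. -/
noncomputable def angular (ν : ℤ) (x : ℂ) : ℂ :=
  Complex.exp (Complex.I * (ν : ℂ) * (Complex.arg x : ℂ))

theorem norm_angular (ν : ℤ) (x : ℂ) : ‖angular ν x‖ = 1 := by
  rw [angular, show Complex.I * (ν : ℂ) * (Complex.arg x : ℂ)
    = ((ν * Complex.arg x : ℝ) : ℂ) * Complex.I by push_cast; ring]
  exact Complex.norm_exp_ofReal_mul_I _

theorem measurable_angular (ν : ℤ) : Measurable (angular ν) := by
  unfold angular
  exact Complex.measurable_exp.comp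
    ((Complex.measurable_ofReal.comp Complex.measurable_arg).const_mul _)

theorem conj_angular (ν : ℤ) (x : ℂ) : starRingEnd ℂ (angular ν x) = angular (-ν) x := by
  rw [angular, angular, ← Complex.exp_conj]
  simp

theorem angular_mul (ν μ : ℤ) (x : ℂ) : angular ν x * angular μ x = angular (ν + μ) x := by
  rw [angular, angular, angular, ← Complex.exp_add]
  push_cast
  ring_nf

theorem integral_exp_int_mul (ν : ℤ) :
    ∫ θ in Set.Ioo (-Real.pi) Real.pi, Complex.exp (Complex.I * (ν : ℂ) * (θ : ℂ))
      = if ν = 0 then (2 * Real.pi : ℂ) else 0 := by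
  rw [← integral_Ioc_eq_integral_Ioo, ← intervalIntegral.integral_of_le
    (by linarith [Real.pi_pos])]
  split_ifs with h
  · subst h
    simp
    ring
  · have hc : Complex.I * (ν : ℂ) ≠ 0 := mul_ne_zero Complex.I_ne_zero (by exact_mod_cast h)
    rw [integral_exp_mul_complex hc, div_eq_zero_iff, sub_eq_zero]
    left
    rw [Complex.exp_eq_exp_iff_exists_int]
    exact ⟨ν, by push_cast; ring⟩

/-- Integration of `a(ρ) e^{iνθ}` over the disk in polar coordinates. -/
theorem integral_mul_angular {R : ℝ} (hR : 0 < R) (a : ℝ → ℂ) (ν : ℤ) :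
    ∫ x, a ‖x‖ * angular ν x ∂diskMeasure R
      = (∫ r in (0 : ℝ)..R, (r : ℂ) * a r) * if ν = 0 then (2 * Real.pi : ℂ) else 0 := by
  rw [diskMeasure, ← integral_indicator measurableSet_ball,
    ← Complex.integral_comp_polarCoord_symm, polarCoord_target]
  have h1 : ∀ p ∈ Set.Ioi (0 : ℝ) ×ˢ Set.Ioo (-Real.pi) Real.pi,
      p.1 • (Metric.ball (0 : ℂ) R).indicator (fun x => a ‖x‖ * angular ν x)
        (Complex.polarCoord.symm p)
      = (Set.Iio R).indicator (fun r : ℝ => (r : ℂ) * a r) p.1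
        * Complex.exp (Complex.I * (ν : ℂ) * (p.2 : ℂ)) := by
    rintro ⟨r, θ⟩ ⟨hr, hθ⟩
    simp only [Set.mem_Ioi] at hr
    have hn : ‖Complex.polarCoord.symm (r, θ)‖ = r := by
      rw [Complex.norm_polarCoord_symm]; exact abs_of_pos hr
    have ha : Complex.arg (Complex.polarCoord.symm (r, θ)) = θ := by
      rw [Complex.polarCoord_symm_apply]
      push_cast
      exact Complex.arg_mul_cos_add_sin_mul_I hr ⟨hθ.1, hθ.2.le⟩
    simp only [Set.indicator, mem_ball_zero_iff, hn, Set.mem_Iio, angular, ha]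
    split_ifs
    · rw [Complex.real_smul]; ring
    · simp
  rw [setIntegral_congr_fun (measurableSet_Ioi.prod measurableSet_Ioo) h1, Measure.volume_eq_prod,
    setIntegral_prod_mul (fun r : ℝ => (Set.Iio R).indicator (fun r : ℝ => (r : ℂ) * a r) r)
      (fun θ : ℝ => Complex.exp (Complex.I * (ν : ℂ) * (θ : ℂ))), integral_exp_int_mul,
    setIntegral_indicator measurableSet_Iio, Set.Ioi_inter_Iio, ← integral_Ioc_eq_integral_Ioo,
    ← intervalIntegral.integral_of_le hR.le]

/-! ### Moments determine a function on the disk -/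

/-- The monomial `x^a x̄^b`. -/
noncomputable def conjMonomial (p : ℕ × ℕ) (x : ℂ) : ℂ :=
  x ^ p.1 * starRingEnd ℂ x ^ p.2

theorem continuous_conjMonomial (p : ℕ × ℕ) : Continuous (conjMonomial p) :=
  (continuous_pow p.1).mul (Complex.continuous_conj.pow p.2)

/-- Stone–Weierstrass on the closed disk, for functions defined on the whole plane. -/
theorem exists_mem_span_conjMonomial_norm_sub_lt (R : ℝ) {g : ℂ → ℂ} (hg : Continuous g) {ε : ℝ}
    (hε : 0 < ε) : ∃ Q ∈ Submodule.span ℂ (Set.range conjMonomial),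
      ∀ x : ℂ, ‖x‖ ≤ R → ‖g x - Q x‖ ≤ ε := by
  set K : Set ℂ := Metric.closedBall 0 R
  have : CompactSpace K := isCompact_iff_compactSpace.1 (isCompact_closedBall 0 R)
  set ι : C(K, ℂ) := ContinuousMap.restrict K (ContinuousMap.id ℂ) with hι
  have htop : (ContinuousMap.restrict K ⟨g, hg⟩ : C(K, ℂ)) ∈ StarAlgebra.elemental ℂ ι := by
    rw [ContinuousMap.elemental_id_eq_top K]; trivial
  have hcl : (ContinuousMap.restrict K ⟨g, hg⟩ : C(K, ℂ))
      ∈ closure ((StarAlgebra.adjoin ℂ {ι} : StarSubalgebra ℂ C(K, ℂ)) : Set C(K, ℂ)) := htop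
  obtain ⟨q, hq, hdist⟩ := Metric.mem_closure_iff.1 hcl ε hε
  have hspan : q ∈ Submodule.span ℂ
      ((Submonoid.closure ({ι, star ι} : Set C(K, ℂ)) : Submonoid C(K, ℂ)) : Set C(K, ℂ)) := by
    have h1 : q ∈ (StarAlgebra.adjoin ℂ {ι}).toSubalgebra := hq
    rw [StarAlgebra.adjoin_toSubalgebra] at h1
    rw [Set.star_singleton, Set.singleton_union] at h1
    rw [← Algebra.adjoin_eq_span]
    exact h1
  have hQ : ∃ Q ∈ Submodule.span ℂ (Set.range conjMonomial), ∀ x : K, q x = Q x := by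
    clear hdist hq
    induction hspan using Submodule.span_induction with
    | mem q hq =>
      obtain ⟨m, n, rfl⟩ := (Submonoid.mem_closure_pair _ _ _).1 hq
      exact ⟨_, Submodule.subset_span ⟨(m, n), rfl⟩, fun x => by simp [conjMonomial, hι]⟩
    | zero => exact ⟨0, zero_mem _, fun x => rfl⟩
    | add q₁ q₂ _ _ h₁ h₂ =>
      obtain ⟨Q₁, m₁, e₁⟩ := h₁
      obtain ⟨Q₂, m₂, e₂⟩ := h₂
      exact ⟨Q₁ + Q₂, add_mem m₁ m₂, fun x => by simp [e₁, e₂]⟩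
    | smul c q _ h =>
      obtain ⟨Q, m, e⟩ := h
      exact ⟨c • Q, Submodule.smul_mem _ c m, fun x => by simp [e]⟩
  obtain ⟨Q, hQm, hQe⟩ := hQ
  refine ⟨Q, hQm, fun x hx => ?_⟩
  have hxK : x ∈ K := by simpa [K] using hx
  have h1 := (ContinuousMap.dist_lt_iff hε).1 hdist ⟨x, hxK⟩
  rw [dist_eq_norm, hQe] at h1
  exact h1.le

/-- An integrable function on the disk all of whose moments `∫ h x^a x̄^b` vanish is zero. -/
theorem ae_eq_zero_of_moments {R : ℝ} {h : ℂ → ℂ} (hh : Integrable h (diskMeasure R))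
    (hm : ∀ a b : ℕ, ∫ x, h x * conjMonomial (a, b) x ∂diskMeasure R = 0) :
    ∀ᵐ x ∂diskMeasure R, h x = 0 := by
  have hint : ∀ g : ℂ → ℂ, Continuous g → Integrable (fun x => h x * g x) (diskMeasure R) := by
    intro g hg
    obtain ⟨C, hC⟩ := (isCompact_closedBall (0 : ℂ) R).exists_bound_of_continuousOn hg.continuousOn
    exact integrable_mul_of_norm_le hh hg.measurable fun x hx => hC x (by simpa using hx.le)
  have hspan : ∀ Q ∈ Submodule.span ℂ (Set.range conjMonomial),
      Continuous Q ∧ ∫ x, h x * Q x ∂diskMeasure R = 0 := by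
    intro Q hQ
    induction hQ using Submodule.span_induction with
    | mem Q hQ =>
      obtain ⟨p, rfl⟩ := hQ
      exact ⟨continuous_conjMonomial p, hm p.1 p.2⟩
    | zero => exact ⟨continuous_const, by simp⟩
    | add Q₁ Q₂ _ _ h₁ h₂ =>
      refine ⟨h₁.1.add h₂.1, ?_⟩
      simp only [Pi.add_apply, mul_add]
      rw [integral_add (hint _ h₁.1) (hint _ h₂.1), h₁.2, h₂.2, add_zero]
    | smul c Q _ h₁ =>
      refine ⟨h₁.1.const_smul c, ?_⟩
      simp only [Pi.smul_apply, smul_eq_mul, mul_left_comm _ c]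
      rw [integral_const_mul, h₁.2, mul_zero]
  refine ae_eq_zero_of_integral_contDiff_smul_eq_zero hh.locallyIntegrable fun g hg _ => ?_
  have hgc : Continuous fun x => (g x : ℂ) := Complex.continuous_ofReal.comp hg.continuous
  have hsm : ∀ x, g x • h x = h x * (g x : ℂ) := fun x => by rw [Complex.real_smul, mul_comm]
  simp only [hsm]
  rw [← norm_le_zero_iff]
  refine le_of_forall_pos_le_add fun δ hδ => ?_
  set I := ∫ x, ‖h x‖ ∂diskMeasure R
  have hI : 0 ≤ I := integral_nonneg fun x => norm_nonneg _
  obtain ⟨Q, hQ, hε⟩ := exists_mem_span_conjMonomial_norm_sub_lt R hgc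
    (ε := δ / (I + 1)) (by positivity)
  obtain ⟨hQc, hQ0⟩ := hspan Q hQ
  have h1 : ∫ x, h x * (g x : ℂ) ∂diskMeasure R
      = ∫ x, h x * ((g x : ℂ) - Q x) ∂diskMeasure R := by
    simp only [mul_sub]
    rw [integral_sub (hint _ hgc) (hint _ hQc), hQ0, sub_zero]
  rw [h1, zero_add]
  calc ‖∫ x, h x * ((g x : ℂ) - Q x) ∂diskMeasure R‖
      ≤ ∫ x, ‖h x‖ * (δ / (I + 1)) ∂diskMeasure R := by
        refine norm_integral_le_of_norm_le (hh.norm.mul_const _) ?_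
        filter_upwards [ae_norm_lt_diskMeasure R] with x hx
        rw [norm_mul]
        exact mul_le_mul_of_nonneg_left (hε x hx.le) (norm_nonneg _)
    _ = I * (δ / (I + 1)) := integral_mul_const _ _
    _ ≤ δ := by
        rw [← mul_div_assoc, div_le_iff₀ (by linarith)]
        nlinarith

/-- The function `ρ^{2m + |ν|} e^{iνθ}`. -/
noncomputable def diskMonomial (ν : ℤ) (m : ℕ) (x : ℂ) : ℂ :=
  (‖x‖ : ℂ) ^ (2 * m + ν.natAbs) * angular ν x

theorem conjMonomial_eq_diskMonomial (a b : ℕ) (x : ℂ) :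
    conjMonomial (a, b) x = diskMonomial ((a : ℤ) - b) (min a b) x := by
  have hx : x = ‖x‖ * angular 1 x := by
    conv_lhs => rw [← Complex.norm_mul_exp_arg_mul_I x]
    rw [angular, Int.cast_one, mul_one, mul_comm Complex.I]
  have hpow : ∀ (ν : ℤ) (n : ℕ), angular ν x ^ n = angular (n * ν) x := fun ν n => by
    rw [angular, angular, ← Complex.exp_nat_mul]
    push_cast
    ring_nf
  have hcx : starRingEnd ℂ x = ‖x‖ * angular (-1) x := by
    conv_lhs => rw [hx]
    rw [map_mul, conj_angular, Complex.conj_ofReal]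
  have hexp : 2 * min a b + ((a : ℤ) - b).natAbs = a + b := by omega
  rw [conjMonomial, diskMonomial, hexp]
  simp only
  rw [hcx]
  conv_lhs => enter [1]; rw [hx]
  rw [mul_pow, mul_pow, hpow, hpow, mul_mul_mul_comm, angular_mul, pow_add]
  congr 2
  ring

/-! ### Completeness in each angular order -/

/-- The function `φ_z(ρ) e^{iνθ}` on the plane. -/
noncomputable def diskRadial (ν : ℤ) (z : ℂ) (x : ℂ) : ℂ :=
  radial ν.natAbs z ‖x‖ * angular ν x

theorem measurable_diskRadial (ν : ℤ) (z : ℂ) : Measurable (diskRadial ν z) :=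
  ((continuous_radial ν.natAbs z).measurable.comp measurable_norm).mul (measurable_angular ν)

theorem exists_norm_diskRadial_le (R : ℝ) (ν : ℤ) (z : ℂ) :
    ∃ C, ∀ x : ℂ, ‖x‖ < R → ‖diskRadial ν z x‖ ≤ C := by
  obtain ⟨C, hC⟩ := (isCompact_Icc (a := (0 : ℝ)) (b := R)).exists_bound_of_continuousOn
    (continuous_radial ν.natAbs z).continuousOn
  refine ⟨C, fun x hx => ?_⟩
  rw [diskRadial, norm_mul, norm_angular, mul_one]
  exact hC _ ⟨norm_nonneg x, hx.le⟩

theorem memLp_diskRadial (R : ℝ) (ν : ℤ) (z : ℂ) :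
    MemLp (diskRadial ν z) 2 (diskMeasure R) := by
  obtain ⟨C, hC⟩ := exists_norm_diskRadial_le R ν z
  refine MemLp.of_bound (measurable_diskRadial ν z).aestronglyMeasurable C ?_
  filter_upwards [ae_norm_lt_diskMeasure R] with x hx using hC x hx

/-- `φ_z(ρ) e^{iνθ}` as an element of `L²` of the disk. -/
noncomputable def radialLp (R : ℝ) (ν : ℤ) (z : ℂ) : Lp ℂ 2 (diskMeasure R) :=
  (memLp_diskRadial R ν z).toLp

theorem coeFn_radialLp (R : ℝ) (ν : ℤ) (z : ℂ) :
    radialLp R ν z =ᵐ[diskMeasure R] diskRadial ν z :=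
  (memLp_diskRadial R ν z).coeFn_toLp

theorem inner_radialLp_radialLp {R : ℝ} (hR : 0 < R) (ν μ : ℤ) (z w : ℂ) :
    inner ℂ (radialLp R ν z) (radialLp R μ w)
      = (∫ r in (0 : ℝ)..R,
          (r : ℂ) * (radial ν.natAbs (starRingEnd ℂ z) r * radial μ.natAbs w r))
        * if μ = ν then (2 * Real.pi : ℂ) else 0 := by
  rw [L2.inner_def]
  have h : ∀ᵐ x ∂diskMeasure R, inner ℂ (radialLp R ν z x) (radialLp R μ w x)
      = (radial ν.natAbs (starRingEnd ℂ z) ‖x‖ * radial μ.natAbs w ‖x‖) * angular (μ - ν) x := by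
    filter_upwards [coeFn_radialLp R ν z, coeFn_radialLp R μ w] with x h1 h2
    rw [h1, h2, RCLike.inner_apply', diskRadial, diskRadial, map_mul, conj_angular, radial_conj,
      sub_eq_neg_add, ← angular_mul]
    ring
  rw [integral_congr_ae h, integral_mul_angular hR
    (fun r => radial ν.natAbs (starRingEnd ℂ z) r * radial μ.natAbs w r)]
  simp only [sub_eq_zero]

theorem norm_radialLp_sq {R : ℝ} (hR : 0 < R) (ν : ℤ) (z : ℂ) :
    ‖radialLp R ν z‖ ^ 2 = 2 * Real.pi * radialNormSq ν.natAbs R z := by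
  have h := inner_radialLp_radialLp hR ν ν z z
  rw [if_pos rfl, inner_self_eq_norm_sq_to_K] at h
  have h2 := ofReal_radialNormSq ν.natAbs R z
  simp only [mul_comm (radial ν.natAbs z _)] at h2
  rw [← h2] at h
  have h3 : ((‖radialLp R ν z‖ ^ 2 : ℝ) : ℂ)
      = ((2 * Real.pi * radialNormSq ν.natAbs R z : ℝ) : ℂ) := by
    push_cast
    rw [mul_comm (2 * (Real.pi : ℂ))]
    exact h
  exact_mod_cast h3

theorem measurable_diskMonomial (ν : ℤ) (m : ℕ) : Measurable (diskMonomial ν m) := by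
  unfold diskMonomial
  exact ((Complex.measurable_ofReal.comp measurable_norm).pow_const _).mul (measurable_angular ν)

theorem norm_diskMonomial_le {R : ℝ} (ν : ℤ) (m : ℕ) {x : ℂ} (hx : ‖x‖ < R) :
    ‖diskMonomial ν m x‖ ≤ R ^ ν.natAbs * (R ^ 2) ^ m := by
  rw [diskMonomial, norm_mul, norm_angular, mul_one, norm_pow, Complex.norm_real, norm_norm,
    ← pow_mul, ← pow_add, add_comm]
  gcongr

theorem hasSum_diskRadial (ν : ℤ) (z x : ℂ) :
    HasSum (fun m => (besselCoeff ν.natAbs m : ℂ) * (-z) ^ m * diskMonomial ν m x)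
      (diskRadial ν z x) := by
  have h := ((entireCoeff_besselCoeff ν.natAbs).summable (-z * (‖x‖ : ℂ) ^ 2)).hasSum
  refine ((h.mul_left ((‖x‖ : ℂ) ^ ν.natAbs)).mul_right (angular ν x)).congr_fun fun m => ?_
  rw [diskMonomial, mul_pow, pow_add, pow_mul]
  ring

/-- The moments of a function on the disk against `ρ^{2m + |ν|} e^{iνθ}`. -/
noncomputable def diskMoment (R : ℝ) (ν : ℤ) (h : ℂ → ℂ) (m : ℕ) : ℂ :=
  ∫ x, h x * diskMonomial ν m x ∂diskMeasure R

theorem integral_norm_mul_diskMonomial_le {R : ℝ} {h : ℂ → ℂ} (hh : Integrable h (diskMeasure R))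
    (ν : ℤ) (m : ℕ) : ∫ x, ‖h x * diskMonomial ν m x‖ ∂diskMeasure R
      ≤ (∫ x, ‖h x‖ ∂diskMeasure R) * R ^ ν.natAbs * (R ^ 2) ^ m := by
  rw [mul_assoc, ← integral_mul_const]
  refine integral_mono_ae (integrable_mul_of_norm_le hh (measurable_diskMonomial ν m)
    fun x hx => norm_diskMonomial_le ν m hx).norm (hh.norm.mul_const _) ?_
  filter_upwards [ae_norm_lt_diskMeasure R] with x hx
  rw [norm_mul]
  exact mul_le_mul_of_nonneg_left (norm_diskMonomial_le ν m hx) (norm_nonneg _)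

theorem entireCoeff_diskMoment {R : ℝ} {h : ℂ → ℂ} (hh : Integrable h (diskMeasure R)) (ν : ℤ) :
    EntireCoeff fun m => (besselCoeff ν.natAbs m : ℂ) * (-1) ^ m * diskMoment R ν h m :=
  .of_norm_le (C := (∫ x, ‖h x‖ ∂diskMeasure R) * |R ^ ν.natAbs|) (K := R ^ 2) fun m => by
    have h1 : ‖diskMoment R ν h m‖
        ≤ (∫ x, ‖h x‖ ∂diskMeasure R) * |R ^ ν.natAbs| * (R ^ 2) ^ m := by
      refine (norm_integral_le_integral_norm _).trans
        ((integral_norm_mul_diskMonomial_le hh ν m).trans ?_)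
      have : 0 ≤ ∫ x, ‖h x‖ ∂diskMeasure R := integral_nonneg fun x => norm_nonneg _
      gcongr
      exact le_abs_self _
    rw [norm_mul, norm_mul, Complex.norm_real, Real.norm_of_nonneg (besselCoeff_pos _ m).le,
      norm_pow, norm_neg, norm_one, one_pow, mul_one]
    calc besselCoeff ν.natAbs m * ‖diskMoment R ν h m‖
        ≤ (1 / (m.factorial : ℝ)) *
          ((∫ x, ‖h x‖ ∂diskMeasure R) * |R ^ ν.natAbs| * (R ^ 2) ^ m) := by
          gcongr
          exact besselCoeff_le _ m
      _ = _ := by ring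

/-- The pairing of `h` with `φ_z(ρ) e^{iνθ}` is an entire function of `z`, whose Taylor
coefficients are the moments of `h`. -/
theorem integral_mul_diskRadial {R : ℝ} {h : ℂ → ℂ}
    (hh : Integrable h (diskMeasure R)) (ν : ℤ) (z : ℂ) :
    ∫ x, h x * diskRadial ν z x ∂diskMeasure R
      = ∑' m, (besselCoeff ν.natAbs m : ℂ) * (-1) ^ m * diskMoment R ν h m * z ^ m := by
  set c : ℕ → ℂ := fun m => (besselCoeff ν.natAbs m : ℂ) * (-z) ^ m with hc
  have hint : ∀ m, Integrable (fun x => c m * (h x * diskMonomial ν m x)) (diskMeasure R) :=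
    fun m => (integrable_mul_of_norm_le hh (measurable_diskMonomial ν m)
      fun x hx => norm_diskMonomial_le ν m hx).const_mul _
  have hsum : Summable fun m => ∫ x, ‖c m * (h x * diskMonomial ν m x)‖ ∂diskMeasure R := by
    have h1 := ((entireCoeff_besselCoeff ν.natAbs).summable_norm (-z * (R : ℂ) ^ 2)).mul_left
      ((∫ x, ‖h x‖ ∂diskMeasure R) * R ^ ν.natAbs)
    refine h1.of_nonneg_of_le (fun m => integral_nonneg fun x => norm_nonneg _) fun m => ?_
    simp only [norm_mul (c m)]
    rw [integral_const_mul]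
    refine (mul_le_mul_of_nonneg_left (integral_norm_mul_diskMonomial_le hh ν m)
      (norm_nonneg _)).trans_eq ?_
    rw [hc, norm_mul, norm_mul, norm_pow, norm_pow, norm_mul, norm_pow, Complex.norm_real R,
      Real.norm_eq_abs R, sq_abs, mul_pow]
    ring
  have key := hasSum_integral_of_summable_integral_norm hint hsum
  have e1 : ∀ x, ∑' m, c m * (h x * diskMonomial ν m x) = h x * diskRadial ν z x := fun x => by
    rw [← (hasSum_diskRadial ν z x).tsum_eq, ← tsum_mul_left]
    exact tsum_congr fun m => by rw [hc]; ring
  simp only [e1] at key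
  rw [← key.tsum_eq]
  refine tsum_congr fun m => ?_
  rw [integral_const_mul, hc, diskMoment, neg_pow]
  ring

theorem integrable_conj {R : ℝ} (f : Lp ℂ 2 (diskMeasure R)) :
    Integrable (fun x => starRingEnd ℂ (f x)) (diskMeasure R) :=
  (Complex.conjLIE.toContinuousLinearEquiv : ℂ →L[ℝ] ℂ).integrable_comp
    ((Lp.memLp f).integrable one_le_two)

theorem inner_radialLp {R : ℝ} (f : Lp ℂ 2 (diskMeasure R)) (ν : ℤ) (z : ℂ) :
    inner ℂ f (radialLp R ν z)
      = ∫ x, starRingEnd ℂ (f x) * diskRadial ν z x ∂diskMeasure R := by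
  rw [L2.inner_def]
  refine integral_congr_ae ?_
  filter_upwards [coeFn_radialLp R ν z] with x hx
  rw [hx, RCLike.inner_apply']

theorem norm_radialLp_mul_abs_im_le {R : ℝ} (hR : 0 < R) (ν : ℤ) (z : ℂ) :
    ‖radialLp R ν z‖ * |z.im|
      ≤ √(2 * Real.pi * (2 + R ^ 2)) / R * √(1 + ‖z‖) * ‖radialFlux ν.natAbs z R‖ := by
  have h1 := abs_im_sq_mul_radialNormSq_le ν.natAbs hR z
  have h2 := norm_radialLp_sq hR ν z
  have hπ := Real.pi_pos
  rw [div_mul_eq_mul_div, div_mul_eq_mul_div, le_div_iff₀ hR]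
  refine abs_le_of_sq_le_sq' ?_ (by positivity) |>.2
  rw [mul_pow, mul_pow, mul_pow, mul_pow, Real.sq_sqrt (by positivity),
    Real.sq_sqrt (by positivity), h2]
  have h3 : 2 + R ^ 2 + 2 * ‖z‖ ≤ (2 + R ^ 2) * (1 + ‖z‖) := by
    nlinarith [norm_nonneg z, sq_nonneg R, mul_nonneg (sq_nonneg R) (norm_nonneg z)]
  calc 2 * Real.pi * radialNormSq ν.natAbs R z * |z.im| ^ 2 * R ^ 2
      = 2 * Real.pi * ((R * |z.im|) ^ 2 * radialNormSq ν.natAbs R z) := by ring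
    _ ≤ 2 * Real.pi * ((2 + R ^ 2 + 2 * ‖z‖) * ‖radialFlux ν.natAbs z R‖ ^ 2) := by gcongr
    _ ≤ 2 * Real.pi * (((2 + R ^ 2) * (1 + ‖z‖)) * ‖radialFlux ν.natAbs z R‖ ^ 2) := by gcongr
    _ = _ := by ring

/-- Completeness of the Bessel functions in angular order `ν`: a function orthogonal to the
eigenfunctions of order `ν` has no moments of angular order `ν`. -/
theorem diskMoment_eq_zero {R : ℝ} (hR : 0 < R) (ν : ℤ) (f : Lp ℂ 2 (diskMeasure R))
    (hf : ∀ k ∈ waveNumbers R ν, inner ℂ f (radialLp R ν ((k : ℂ) ^ 2)) = 0) (m : ℕ) :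
    diskMoment R ν (fun x => starRingEnd ℂ (f x)) m = 0 := by
  have hh := integrable_conj f
  have hcoef := entireCoeff_diskMoment hh ν
  have hF : (fun z => inner ℂ f (radialLp R ν z)) = fun z => ∑' m,
      (besselCoeff ν.natAbs m : ℂ) * (-1) ^ m
        * diskMoment R ν (fun x => starRingEnd ℂ (f x)) m * z ^ m :=
    funext fun z => (inner_radialLp f ν z).trans (integral_mul_diskRadial hh ν z)
  have hdF : Differentiable ℂ fun z => inner ℂ f (radialLp R ν z) := by
    rw [hF]; exact hcoef.differentiable
  have h0 : ∀ z, inner ℂ f (radialLp R ν z) = 0 := by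
    refine eq_zero_of_norm_mul_abs_im_le_mul hdF (differentiable_radialFlux ν.natAbs R)
      (fun z hz => ⟨deriv_radialFlux_ne_zero hR hz, ?_⟩)
      (fun z hz => im_eq_zero_of_radialFlux_eq_zero hR hz)
      (C := ‖f‖ * (√(2 * Real.pi * (2 + R ^ 2)) / R)) (by positivity) fun z => ?_
    · obtain ⟨k, hk, rfl⟩ := exists_mem_waveNumbers_of_radialFlux_eq_zero hR ν hz
      exact hf k hk
    · calc ‖inner ℂ f (radialLp R ν z)‖ * |z.im|
          ≤ ‖f‖ * ‖radialLp R ν z‖ * |z.im| := by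
            gcongr; exact norm_inner_le_norm _ _
        _ = ‖f‖ * (‖radialLp R ν z‖ * |z.im|) := by ring
        _ ≤ ‖f‖ * (√(2 * Real.pi * (2 + R ^ 2)) / R * √(1 + ‖z‖)
            * ‖radialFlux ν.natAbs z R‖) := by
            exact mul_le_mul_of_nonneg_left (norm_radialLp_mul_abs_im_le hR ν z) (norm_nonneg f)
        _ = _ := by ring
  have h1 := hcoef.eq_zero (fun z => (congrFun hF z).symm.trans (h0 z)) m
  have h2 : (besselCoeff ν.natAbs m : ℂ) ≠ 0 := by exact_mod_cast (besselCoeff_pos _ m).ne'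
  have h3 : ((-1 : ℂ)) ^ m ≠ 0 := pow_ne_zero _ (by norm_num)
  exact (mul_eq_zero.1 h1).resolve_left (mul_ne_zero h2 h3)

/-! ### The wave numbers form an increasing sequence -/

theorem memLp_diskMonomial (R : ℝ) (ν : ℤ) (m : ℕ) :
    MemLp (diskMonomial ν m) 2 (diskMeasure R) := by
  refine MemLp.of_bound (measurable_diskMonomial ν m).aestronglyMeasurable
    (R ^ ν.natAbs * (R ^ 2) ^ m) ?_
  filter_upwards [ae_norm_lt_diskMeasure R] with x hx using norm_diskMonomial_le ν m hx

theorem diskMeasure_ne_zero {R : ℝ} (hR : 0 < R) : diskMeasure R ≠ 0 := by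
  rw [diskMeasure, Ne, Measure.restrict_eq_zero]
  exact (Metric.measure_ball_pos volume 0 hR).ne'

theorem ae_norm_notMem_finset (R : ℝ) (T : Finset ℝ) : ∀ᵐ x ∂diskMeasure R, ‖x‖ ∉ T := by
  refine ae_restrict_of_ae ?_
  have h : ∀ t ∈ T, ∀ᵐ x : ℂ, ‖x‖ ≠ t := fun t _ => by
    have := Measure.addHaar_sphere (volume : Measure ℂ) 0 t
    rw [ae_iff]
    convert this using 2
    ext x
    simp
  filter_upwards [(Finset.eventually_all T).2 h] with x hx hmem
  exact hx _ hmem rfl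

theorem linearIndependent_diskMonomial {R : ℝ} (hR : 0 < R) (ν : ℤ) :
    LinearIndependent ℂ fun m => (memLp_diskMonomial R ν m).toLp := by
  rw [linearIndependent_iff']
  intro s a hsum
  have h1 : ∀ᵐ x ∂diskMeasure R, ∑ m ∈ s, a m * diskMonomial ν m x = 0 := by
    have e1 := Lp.coeFn_fun_finsetSum s fun m => a m • (memLp_diskMonomial R ν m).toLp
    rw [hsum] at e1
    have e2 : ∀ m ∈ s, ∀ᵐ x ∂diskMeasure R,
        (a m • (memLp_diskMonomial R ν m).toLp : Lp ℂ 2 (diskMeasure R)) x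
          = a m * diskMonomial ν m x := fun m _ => by
      filter_upwards [Lp.coeFn_smul (a m) (memLp_diskMonomial R ν m).toLp,
        (memLp_diskMonomial R ν m).coeFn_toLp] with x h1 h2
      rw [h1, Pi.smul_apply, h2, smul_eq_mul]
    filter_upwards [e1, (Finset.eventually_all s).2 e2, Lp.coeFn_zero ℂ 2 (diskMeasure R)]
      with x h1 h2 h3
    rw [← Finset.sum_congr rfl h2, ← h1, h3, Pi.zero_apply]
  set q : Polynomial ℂ := ∑ m ∈ s, Polynomial.C (a m) * Polynomial.X ^ m with hq
  have hq0 : q = 0 := by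
    by_contra hne
    set T : Finset ℝ := insert 0 (q.roots.toFinset.image fun w => √‖w‖)
    have h2 : ∀ᵐ x ∂diskMeasure R, False := by
      filter_upwards [h1, ae_norm_notMem_finset R T] with x hx hT
      have hx0 : ‖x‖ ≠ 0 := fun h => hT (by simp [T, h])
      have hroot : q.eval ((‖x‖ : ℂ) ^ 2) = 0 := by
        have e : ∑ m ∈ s, a m * diskMonomial ν m x
            = q.eval ((‖x‖ : ℂ) ^ 2) * ((‖x‖ : ℂ) ^ ν.natAbs * angular ν x) := by
          rw [hq, Polynomial.eval_finsetSum, Finset.sum_mul]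
          refine Finset.sum_congr rfl fun m _ => ?_
          simp only [Polynomial.eval_mul, Polynomial.eval_C, Polynomial.eval_pow,
            Polynomial.eval_X, diskMonomial]
          rw [pow_add, pow_mul]
          ring
        rw [e] at hx
        refine (mul_eq_zero.1 hx).resolve_right (mul_ne_zero (pow_ne_zero _ ?_)
          (Complex.exp_ne_zero _))
        exact_mod_cast hx0
      refine hT (Finset.mem_insert_of_mem (Finset.mem_image.2 ⟨(‖x‖ : ℂ) ^ 2, ?_, ?_⟩))
      · rw [Multiset.mem_toFinset, Polynomial.mem_roots hne]
        exact hroot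
      · rw [norm_pow, Complex.norm_real, norm_norm, Real.sqrt_sq (norm_nonneg x)]
    rw [Filter.eventually_false_iff_eq_bot, ae_eq_bot] at h2
    exact diskMeasure_ne_zero hR h2
  intro m hm
  have := congrArg (fun p => Polynomial.coeff p m) hq0
  simpa [hq, Polynomial.finsetSum_coeff, Polynomial.coeff_C_mul, Polynomial.coeff_X_pow, hm]
    using this

/-- There are infinitely many wave numbers: otherwise, by completeness, the infinitely many
independent functions `ρ^{2m + |ν|} e^{iνθ}` would lie in the span of finitely many
eigenfunctions. -/
theorem waveNumbers_infinite {R : ℝ} (hR : 0 < R) (ν : ℤ) : (waveNumbers R ν).Infinite := by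
  intro hfin
  set S : Submodule ℂ (Lp ℂ 2 (diskMeasure R)) :=
    Submodule.span ℂ ((fun k : ℝ => radialLp R ν ((k : ℂ) ^ 2)) '' waveNumbers R ν) with hS
  have : FiniteDimensional ℂ S := FiniteDimensional.span_of_finite ℂ (hfin.image _)
  have hmem : ∀ m, (memLp_diskMonomial R ν m).toLp ∈ S := fun m => by
    rw [← Submodule.orthogonal_orthogonal S, Submodule.mem_orthogonal]
    intro f hf
    rw [Submodule.mem_orthogonal'] at hf
    have h0 := diskMoment_eq_zero hR ν f
      (fun k hk => hf _ (Submodule.subset_span ⟨k, hk, rfl⟩)) m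
    rw [L2.inner_def, ← h0, diskMoment]
    refine integral_congr_ae ?_
    filter_upwards [(memLp_diskMonomial R ν m).coeFn_toLp] with x hx
    rw [hx, RCLike.inner_apply']
  have hli : LinearIndependent ℂ fun m => (⟨_, hmem m⟩ : S) :=
    LinearIndependent.of_comp S.subtype (linearIndependent_diskMonomial hR ν)
  have := hli.finite_of_isNoetherian
  exact not_finite ℕ

/-- An infinite set of reals with finitely many elements below each bound is the range of a
strictly increasing sequence. -/
theorem exists_strictMono_range_eq {s : Set ℝ} (hs : s.Infinite)
    (hfin : ∀ M, (s ∩ Set.Iic M).Finite) :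
    ∃ κ : ℕ → ℝ, StrictMono κ ∧ Set.range κ = s := by
  set rank : s → ℕ := fun x => (s ∩ Set.Iic (x : ℝ)).ncard
  have hrank : StrictMono rank := fun x y hxy => by
    refine Set.ncard_lt_ncard ⟨fun w hw =>
      ⟨hw.1, Set.Iic_subset_Iic.2 (Subtype.coe_le_coe.2 hxy.le) hw.2⟩, fun h => ?_⟩ (hfin y)
    exact absurd (h ⟨y.2, le_refl (y : ℝ)⟩).2 (not_le.2 hxy)
  have : Infinite s := hs.to_subtype
  have : Infinite (Set.range rank) := (Set.infinite_range_of_injective hrank.injective).to_subtype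
  set e : ℕ ≃o s := (Nat.Subtype.orderIsoOfNat (Set.range rank)).trans (hrank.orderIso rank).symm
  refine ⟨fun j => e j, fun i j hij => e.strictMono hij, ?_⟩
  ext x
  constructor
  · rintro ⟨j, rfl⟩
    exact (e j).2
  · intro hx
    exact ⟨e.symm ⟨x, hx⟩, by simp⟩

/-! ### The orthonormal basis -/

/-- The real factor that turns `φ_{k²}(ρ) e^{iνθ}` into the normalised mode. -/
noncomputable def modeCoeff (R : ℝ) (ν : ℤ) (k : ℝ) : ℝ :=
  besselNorm R ν k * besselScale ν k

theorem besselMode_eq (R : ℝ) (ν : ℤ) (k : ℝ) (x : ℂ) :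
    besselMode R ν k ‖x‖ (Complex.arg x)
      = (modeCoeff R ν k : ℂ) * diskRadial ν ((k : ℂ) ^ 2) x := by
  rw [besselMode, besselJ_mul_eq, modeCoeff, diskRadial, angular]
  push_cast
  ring

theorem integral_mul_besselJ_sq (R : ℝ) (ν : ℤ) (k : ℝ) :
    ∫ ρ in (0 : ℝ)..R, ρ * besselJ ν (k * ρ) ^ 2
      = besselScale ν k ^ 2 * radialNormSq ν.natAbs R ((k : ℂ) ^ 2) := by
  rw [radialNormSq, ← intervalIntegral.integral_const_mul]
  congr 1 with ρ
  have h : ‖(besselJ ν (k * ρ) : ℂ)‖ ^ 2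
      = ‖(besselScale ν k : ℂ) * radial ν.natAbs ((k : ℂ) ^ 2) ρ‖ ^ 2 := by
    rw [besselJ_mul_eq]
  rw [norm_mul, mul_pow, Complex.norm_real, Complex.norm_real, Real.norm_eq_abs, sq_abs,
    Real.norm_eq_abs, sq_abs] at h
  rw [h]
  ring

theorem besselScale_ne_zero_of_mem {R : ℝ} {ν : ℤ} {k : ℝ} (hk : k ∈ waveNumbers R ν) :
    besselScale ν k ≠ 0 := by
  rcases hk.1 with h | ⟨rfl, rfl⟩
  · exact besselScale_ne_zero ν h.ne'
  · simp [besselScale]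

theorem modeCoeff_sq_mul {R : ℝ} (hR : 0 < R) {ν : ℤ} {k : ℝ} (hk : k ∈ waveNumbers R ν) :
    modeCoeff R ν k ^ 2 * (2 * Real.pi * radialNormSq ν.natAbs R ((k : ℂ) ^ 2)) = 1 := by
  have hs := besselScale_ne_zero_of_mem hk
  have ha := radialNormSq_pos ν.natAbs hR ((k : ℂ) ^ 2)
  have hπ := Real.pi_pos
  rw [modeCoeff, mul_pow, besselNorm, integral_mul_besselJ_sq, div_pow,
    Real.sq_sqrt (by positivity)]
  field_simp

theorem modeCoeff_ne_zero {R : ℝ} (hR : 0 < R) {ν : ℤ} {k : ℝ} (hk : k ∈ waveNumbers R ν) :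
    modeCoeff R ν k ≠ 0 := fun h => by
  have := modeCoeff_sq_mul hR hk
  simp [h] at this

/-- The normalised mode as an element of `L²` of the disk. -/
noncomputable def modeLp (R : ℝ) (ν : ℤ) (k : ℝ) : Lp ℂ 2 (diskMeasure R) :=
  (modeCoeff R ν k : ℂ) • radialLp R ν ((k : ℂ) ^ 2)

theorem coeFn_modeLp (R : ℝ) (ν : ℤ) (k : ℝ) :
    modeLp R ν k =ᵐ[diskMeasure R] fun x => besselMode R ν k ‖x‖ (Complex.arg x) := by
  filter_upwards [Lp.coeFn_smul (modeCoeff R ν k : ℂ) (radialLp R ν ((k : ℂ) ^ 2)),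
    coeFn_radialLp R ν ((k : ℂ) ^ 2)] with x h1 h2
  rw [modeLp, h1, Pi.smul_apply, h2, smul_eq_mul, besselMode_eq]

theorem norm_modeLp {R : ℝ} (hR : 0 < R) {ν : ℤ} {k : ℝ} (hk : k ∈ waveNumbers R ν) :
    ‖modeLp R ν k‖ = 1 := by
  have h : ‖modeLp R ν k‖ ^ 2 = 1 := by
    rw [modeLp, norm_smul, mul_pow, norm_radialLp_sq hR, Complex.norm_real, Real.norm_eq_abs,
      sq_abs, modeCoeff_sq_mul hR hk]
  exact (pow_eq_one_iff_of_nonneg (norm_nonneg _) two_ne_zero).1 h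

theorem inner_modeLp_eq_zero {R : ℝ} (hR : 0 < R) {ν μ : ℤ} {k l : ℝ}
    (hk : k ∈ waveNumbers R ν) (hl : l ∈ waveNumbers R μ) (hne : ν = μ → k ≠ l) :
    inner ℂ (modeLp R ν k) (modeLp R μ l) = 0 := by
  rw [modeLp, modeLp, inner_smul_left, inner_smul_right, inner_radialLp_radialLp hR]
  split_ifs with h
  · subst h
    obtain ⟨hk0, hk1⟩ := (mem_waveNumbers_iff hR μ k).1 hk
    obtain ⟨hl0, hl1⟩ := (mem_waveNumbers_iff hR μ l).1 hl
    have hL := lagrange_identity μ.natAbs ((k : ℂ) ^ 2) ((l : ℂ) ^ 2) R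
    rw [hk1, hl1, mul_zero, zero_mul, sub_zero, mul_eq_zero, sub_eq_zero] at hL
    have hkl : (k : ℂ) ^ 2 ≠ (l : ℂ) ^ 2 := fun h => by
      have h' : k ^ 2 = l ^ 2 := by exact_mod_cast h
      exact hne rfl ((pow_left_inj₀ hk0 hl0 two_ne_zero).1 h')
    simp only [map_pow, Complex.conj_ofReal]
    rw [hL.resolve_left hkl, zero_mul, mul_zero, mul_zero]
  · simp

/-- A function orthogonal to all modes vanishes. -/
theorem eq_zero_of_inner_modeLp_eq_zero {R : ℝ} (hR : 0 < R) (f : Lp ℂ 2 (diskMeasure R))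
    (hf : ∀ ν, ∀ k ∈ waveNumbers R ν, inner ℂ f (modeLp R ν k) = 0) : f = 0 := by
  have hf' : ∀ ν, ∀ k ∈ waveNumbers R ν, inner ℂ f (radialLp R ν ((k : ℂ) ^ 2)) = 0 := by
    intro ν k hk
    have h := hf ν k hk
    rw [modeLp, inner_smul_right] at h
    exact (mul_eq_zero.1 h).resolve_left (by exact_mod_cast modeCoeff_ne_zero hR hk)
  have h0 := ae_eq_zero_of_moments (integrable_conj f) fun a b => by
    simp only [conjMonomial_eq_diskMonomial]
    exact diskMoment_eq_zero hR _ f (hf' _) _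
  rw [Lp.eq_zero_iff_ae_eq_zero]
  filter_upwards [h0] with x hx
  simpa using hx

theorem theorem1 (R : ℝ) (hR : 0 < R) :
    (∀ ν : ℤ, ∃ κ : ℕ → ℝ, StrictMono κ ∧ Set.range κ = waveNumbers R ν) ∧
    ∀ k : ℤ → ℕ → ℝ,
      (∀ ν : ℤ, Function.Injective (k ν) ∧ Set.range (k ν) = waveNumbers R ν) →
      ∃ b : HilbertBasis (ℤ × ℕ) ℂ (Lp ℂ 2 (diskMeasure R)),
        ∀ (ν : ℤ) (j : ℕ),
          (b (ν, j) : ℂ → ℂ) =ᵐ[diskMeasure R]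
            fun z : ℂ => besselMode R ν (k ν j) ‖z‖ (Complex.arg z) := by
  refine ⟨fun ν => exists_strictMono_range_eq (waveNumbers_infinite hR ν)
    (waveNumbers_inter_Iic_finite hR ν), fun k hk => ?_⟩
  have hmem : ∀ ν j, k ν j ∈ waveNumbers R ν := fun ν j => (hk ν).2 ▸ Set.mem_range_self j
  set v : ℤ × ℕ → Lp ℂ 2 (diskMeasure R) := fun p => modeLp R p.1 (k p.1 p.2) with hv
  have horth : Orthonormal ℂ v := by
    refine ⟨fun p => norm_modeLp hR (hmem p.1 p.2), fun p q hpq => ?_⟩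
    refine inner_modeLp_eq_zero hR (hmem p.1 p.2) (hmem q.1 q.2) fun h1 h2 => hpq ?_
    obtain ⟨ν, i⟩ := p
    obtain ⟨μ, j⟩ := q
    simp only at h1 h2
    subst h1
    rw [(hk ν).1 h2]
  have hbot : (Submodule.span ℂ (Set.range v))ᗮ = ⊥ := by
    rw [Submodule.eq_bot_iff]
    intro f hf
    rw [Submodule.mem_orthogonal'] at hf
    refine eq_zero_of_inner_modeLp_eq_zero hR f fun ν κ hκ => ?_
    obtain ⟨j, rfl⟩ : κ ∈ Set.range (k ν) := (hk ν).2 ▸ hκ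
    exact hf _ (Submodule.subset_span ⟨(ν, j), rfl⟩)
  refine ⟨HilbertBasis.mkOfOrthogonalEqBot horth hbot, fun ν j => ?_⟩
  rw [HilbertBasis.coe_mkOfOrthogonalEqBot]
  exact coeFn_modeLp R ν (k ν j)
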